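/- Let $\mathbb K$ be a field with $2\neq 0$ and let $N\ge 1$. Consider the network of $N$ squares, closed up cyclically (indices of edge weights are read mod $N$). The $i$-th square has a left edge $\alpha_i$ (going up), a bottom edge $\beta_i$, a right edge $\gamma_i$ (going down) and a top edge $\delta_i$; $p_i$ enters its upper left corner and $q_i$ leaves its upper right corner, $q_{i-1}$ enters its lower left and $p_{i+1}$ leaves its lower right corner. A double bracket on a unital associative algebra $R$ is a bilinear map $\{\!\{-,-\}\!\}:R\times R\to R\otimes R$ with $\{\!\{u,v\}\!\}=-\{\!\{v,u\}\!\}^{\tau}$, where $(x\otimes y)^\tau=y\otimes x$, and $\{\!\{u,vw\}\!\}=\{\!\{u,v\}\!\}(1\otimes w)+(v\otimes 1)\{\!\{u,w\}\!\}$. The network double bracket is determined by $$\{\!\{\alpha_i,p_i\}\!\}=\tfrac12\,p_i\otimes\alpha_i,\quad \{\!\{\beta_i,\alpha_i\}\!\}=\tfrac12\,\beta_i\otimes\alpha_i,\quad \{\!\{\gamma_i,q_i\}\!\}=\tfrac12\,\gamma_i\otimes q_i,\quad \{\!\{\beta_i,\gamma_i\}\!\}=\tfrac12\,\gamma_i\otimes\beta_i,$$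 all other brackets of two edge weights being zero up to skew symmetry. It induces a bracket $\langle u^\natural,v^\natural\rangle=\mu(\{\!\{u,v\}\!\})^\natural$ on $R^\natural=R/[R,R]$, where $\mu$ is the multiplication and $[R,R]$ the linear span of the commutators. Put $a_i=\alpha_ip_i^{-1}$, $b_i=\beta_i$, $c_i=q_i^{-1}\gamma_i$, $d_i=p_i\delta_iq_i$, $z_i=d_1c_1\cdots d_{i-1}c_{i-1}d_i$, and $$X_i=z_{i-1}a_ic_{i-1}^{-1}z_{i-1}^{-1},\quad Y_i=z_{i-1}b_ic_i^{-1}d_i^{-1}c_{i-1}^{-1}z_{i-1}^{-1}\quad(2\le i\le N),$$ $$X_1=c_N^{-1}a_1,\quad Y_1=c_N^{-1}b_1c_1^{-1}d_1^{-1},\quad Z=z_Nc_N.$$ Set $X_0=Z^{-1}X_NZ$, $X_{N+1}=ZX_1Z^{-1}$, and likewise for $Y$. The leapfrog map $T$ sends $(X_i,Y_i,Z)_{1\le i\le N}$ to $$\tilde X_i=(X_{i-1}+Y_{i-1})^{-1}X_{i-1}(X_i+Y_i),\quad \tilde Y_i=(X_i+Y_i)^{-1}Y_i(X_{i+1}+Y_{i+1}),\quad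 \tilde Z=Z.$$ **Theorem.** Let $R$ be the free skew field over $\mathbb K$ on the $6N$ edge weights, with its network double bracket; or, more generally, let $R$ be any unital associative $\mathbb K$-algebra with a double bracket and with elements $\alpha_i,\dots,q_i$ satisfying the relations above, such that all these elements and all $f_i=b_i+a_id_ic_i$ are invertible. Then: 1. $T$ is realized by the Postnikov moves. With $\tilde a_i=d_ic_if_i^{-1}$, $\tilde b_i=f_i$, $\tilde c_i=f_i^{-1}a_id_i$, $\tilde d_i=d_ic_if_i^{-1}b_ic_i^{-1}$ and $\xi_i=\tilde a_1\tilde b_1\cdots\tilde a_i\tilde b_i$, one has for $1\le i\le N$ $$\tilde X_i=\xi_{i-1}\tilde c_{i-1}\tilde a_i^{-1}\xi_{i-1}^{-1},\quad \tilde Y_i=\xi_{i-1}\tilde d_i\tilde a_{i+1}^{-1}\tilde b_i^{-1}\tilde a_i^{-1}\xi_{i-1}^{-1},\quad \tilde Z=\xi_N.$$ 2. The brackets are invariant under $T$: the following relations in $R^\natural$, for all $1\le i,j\le N$, hold for $(X_i,Y_i,Z)$, and they hold with $(X_i,Y_i,Z)$ replaced by $(\tilde X_i,\tilde Y_i,\tilde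 Z)$: $$\langle X_i,X_j\rangle=0,\qquad \langle Z,X_i\rangle=\langle Z,Y_i\rangle=\langle Z,Z\rangle=0,$$ $$\langle Y_i,X_j\rangle=\delta_{i,j}\,Y_iX_j-\delta_{j,i+1}\,X_jY_i-\delta_{j,1}\delta_{i,N}\,X_1Z^{-1}Y_NZ,$$ $$\langle Y_i,Y_j\rangle=\delta_{i,j+1}\,Y_iY_j-\delta_{j,i+1}\,Y_jY_i+(\delta_{i,1}\delta_{j,N}-\delta_{j,1}\delta_{i,N})\,Y_1Z^{-1}Y_NZ.$$ For $N\ge3$ the non-zero relations say precisely that $\langle Y_i,X_i\rangle=Y_iX_i$ for $1\le i\le N$, $\langle X_{i+1},Y_i\rangle=X_{i+1}Y_i$ and $\langle Y_{i+1},Y_i\rangle=Y_{i+1}Y_i$ for $1\le i<N$, $\langle X_1,Y_N\rangle=X_1Z^{-1}Y_NZ$ and $\langle Y_1,Y_N\rangle=Y_1Z^{-1}Y_NZ$. -/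

import Mathlib

open scoped TensorProduct Ring

/-! ## Double brackets and the induced bracket on the cyclic space -/

/-- A double bracket on an associative `K`-algebra `A`. The products on the right of `leibniz` are
taken in the algebra `A ⊗ A`, and `TensorProduct.comm` is the flip `x ⊗ y ↦ y ⊗ x`. -/
structure DoubleBracket (K A : Type*) [Field K] [Ring A] [Algebra K A] where
  /-- the bilinear map `(a, b) ↦ ⦃a, b⦄` -/
  br : A →ₗ[K] A →ₗ[K] A ⊗[K] A
  skew : ∀ a b, br a b = -TensorProduct.comm K A A (br b a)
  leibniz : ∀ a b c, br a (b * c) = br a b * (1 ⊗ₜ[K] c) + (b ⊗ₜ[K] 1) * br a c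

section Cyclic

variable (K A : Type*) [Field K] [Ring A] [Algebra K A]

/-- The linear span `[A, A]` of all commutators. -/
def commutatorSpan : Submodule K A :=
  Submodule.span K (Set.range fun x : A × A => x.1 * x.2 - x.2 * x.1)

/-- The cyclic space `A^♮ = A / [A, A]`. -/
abbrev CyclicSpace : Type _ := A ⧸ commutatorSpan K A

variable {A}

/-- The class `a^♮` of `a` in the cyclic space. -/
def cyc : A →ₗ[K] CyclicSpace K A := (commutatorSpan K A).mkQ

theorem cyc_mul_comm (a b : A) : cyc K (a * b) = cyc K (b * a) := by
  rw [← sub_eq_zero, ← map_sub, cyc, Submodule.mkQ_apply, Submodule.Quotient.mk_eq_zero]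
  exact Submodule.subset_span ⟨(a, b), rfl⟩

end Cyclic

namespace DoubleBracket

variable {K A : Type*} [Field K] [Ring A] [Algebra K A] (D : DoubleBracket K A)

theorem eq_of_br {D D' : DoubleBracket K A} (h : D.br = D'.br) : D = D' := by
  cases D; cases D'; cases h; rfl

/-- The operation `{a, b} = μ(⦃a, b⦄)`, where `μ` is the multiplication of `A`. -/
def ind : A →ₗ[K] A →ₗ[K] A := D.br.compr₂ (LinearMap.mul' K A)

theorem ind_apply (a b : A) : D.ind a b = LinearMap.mul' K A (D.br a b) := rfl

theorem mul'_mul_right (m : A ⊗[K] A) (c : A) :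
    LinearMap.mul' K A (m * (1 ⊗ₜ[K] c)) = LinearMap.mul' K A m * c := by
  induction m with
  | zero => simp
  | tmul x y => simp [mul_assoc]
  | add x y hx hy => simp [add_mul, hx, hy]

theorem mul'_mul_left (m : A ⊗[K] A) (b : A) :
    LinearMap.mul' K A ((b ⊗ₜ[K] 1) * m) = b * LinearMap.mul' K A m := by
  induction m with
  | zero => simp
  | tmul x y => simp [mul_assoc]
  | add x y hx hy => simp [mul_add, hx, hy]

theorem cyc_mul'_comm (m : A ⊗[K] A) :
    cyc K (LinearMap.mul' K A (TensorProduct.comm K A A m)) = cyc K (LinearMap.mul' K A m) := by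
  induction m with
  | zero => simp
  | tmul x y => simpa using cyc_mul_comm K y x
  | add x y hx hy => simp only [map_add] at hx hy ⊢; rw [hx, hy]

theorem ind_mul (a b c : A) : D.ind a (b * c) = D.ind a b * c + b * D.ind a c := by
  simp only [ind_apply, D.leibniz, map_add, mul'_mul_right, mul'_mul_left]

theorem cyc_ind_skew (a b : A) : cyc K (D.ind a b) = -cyc K (D.ind b a) := by
  rw [ind_apply, D.skew a b, map_neg, map_neg, cyc_mul'_comm, ind_apply]

theorem cyc_ind_right (a : A) {b : A} (hb : b ∈ commutatorSpan K A) : cyc K (D.ind a b) = 0 := by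
  refine Submodule.span_induction (p := fun b _ => cyc K (D.ind a b) = 0) ?_ ?_ ?_ ?_ hb
  · rintro _ ⟨⟨x, y⟩, rfl⟩
    have h1 := cyc_mul_comm K (D.ind a x) y
    have h2 := cyc_mul_comm K x (D.ind a y)
    simp only [map_sub, ind_mul, map_add] at h1 h2 ⊢
    rw [h1, h2]; abel
  · simp
  · intro x y _ _ hx hy; simp only [map_add] at hx hy ⊢; rw [hx, hy, add_zero]
  · intro k x _ hx; simp only [map_smul] at hx ⊢; rw [hx, smul_zero]

theorem cyc_ind_left {a : A} (b : A) (ha : a ∈ commutatorSpan K A) : cyc K (D.ind a b) = 0 := by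
  rw [cyc_ind_skew, cyc_ind_right D b ha, neg_zero]

/-- The bracket `⟨a^♮, b^♮⟩ = {a, b}^♮` on the cyclic space. -/
def cyclicBracket : CyclicSpace K A →ₗ[K] CyclicSpace K A →ₗ[K] CyclicSpace K A :=
  (commutatorSpan K A).liftQ
    { toFun := fun a => (commutatorSpan K A).liftQ (cyc K ∘ₗ D.ind a)
        fun _ hb => D.cyc_ind_right a hb
      map_add' := fun a b => Submodule.linearMap_qext _ <| by ext c; simp; rfl
      map_smul' := fun k a => Submodule.linearMap_qext _ <| by ext c; simp; rfl }
    fun a ha => Submodule.linearMap_qext _ <| by ext b; exact D.cyc_ind_left b ha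

theorem cyclicBracket_cyc (a b : A) : D.cyclicBracket (cyc K a) (cyc K b) = cyc K (D.ind a b) := rfl

end DoubleBracket

/-! ## The free skew field and the extension of brackets to it -/

section FreeSkewField

variable (K : Type*) [Field K] (E : Type*)

/-- A square matrix over the free algebra `K⟨E⟩` is full if it is not a product of an `n × m` and an
`m × n` matrix with `m < n`. -/
def IsFull {K : Type*} [Field K] {E : Type*} {n : ℕ}
    (M : Matrix (Fin n) (Fin n) (FreeAlgebra K E)) : Prop :=
  ∀ m < n, ∀ (B : Matrix (Fin n) (Fin m) (FreeAlgebra K E))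
    (C : Matrix (Fin m) (Fin n) (FreeAlgebra K E)), M ≠ B * C

/-- Generators: the indeterminates, and the entries of a formal inverse of every full matrix. -/
inductive LocGen
  | of (e : E) : LocGen
  | inv (n : ℕ) (M : Matrix (Fin n) (Fin n) (FreeAlgebra K E)) (hM : IsFull M) (i j : Fin n) : LocGen

/-- The inclusion of the free algebra on the indeterminates. -/
noncomputable def LocGen.emb : FreeAlgebra K E →ₐ[K] FreeAlgebra K (LocGen K E) :=
  FreeAlgebra.lift K fun e => FreeAlgebra.ι K (LocGen.of e)

/-- The formal inverse of a full matrix. -/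
noncomputable def LocGen.invMat {n : ℕ} (M : Matrix (Fin n) (Fin n) (FreeAlgebra K E))
    (hM : IsFull M) : Matrix (Fin n) (Fin n) (FreeAlgebra K (LocGen K E)) :=
  Matrix.of fun i j => FreeAlgebra.ι K (LocGen.inv n M hM i j)

/-- The relations `M M⁻¹ = 1` and `M⁻¹ M = 1`, entry by entry. -/
inductive LocRel : FreeAlgebra K (LocGen K E) → FreeAlgebra K (LocGen K E) → Prop
  | right (n : ℕ) (M : Matrix (Fin n) (Fin n) (FreeAlgebra K E)) (hM : IsFull M) (i j : Fin n) :
      LocRel ((M.map (LocGen.emb K E) * LocGen.invMat K E M hM) i j)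
        ((1 : Matrix (Fin n) (Fin n) (FreeAlgebra K (LocGen K E))) i j)
  | left (n : ℕ) (M : Matrix (Fin n) (Fin n) (FreeAlgebra K E)) (hM : IsFull M) (i j : Fin n) :
      LocRel ((LocGen.invMat K E M hM * M.map (LocGen.emb K E)) i j)
        ((1 : Matrix (Fin n) (Fin n) (FreeAlgebra K (LocGen K E))) i j)

/-- The free skew field on a set `E` of indeterminates over `K`, in Cohn's construction: the
universal localization of the free algebra `K⟨E⟩` at the set of all full matrices. -/
def FreeSkewField : Type _ := RingQuot (LocRel K E)

noncomputable instance : Ring (FreeSkewField K E) := inferInstanceAs (Ring (RingQuot (LocRel K E)))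

noncomputable instance : Algebra K (FreeSkewField K E) :=
  inferInstanceAs (Algebra K (RingQuot (LocRel K E)))

namespace FreeSkewField

/-- The canonical map from the presentation. -/
noncomputable def mk : FreeAlgebra K (LocGen K E) →ₐ[K] FreeSkewField K E :=
  RingQuot.mkAlgHom K (LocRel K E)

variable {E}

/-- The indeterminate `e`, as an element of the free skew field. -/
noncomputable def ι (e : E) : FreeSkewField K E := mk K E (FreeAlgebra.ι K (LocGen.of e))

variable (E)

/-- The free algebra maps to the free skew field. -/
noncomputable def ofFree : FreeAlgebra K E →ₐ[K] FreeSkewField K E := FreeAlgebra.lift K (ι K)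

theorem ofFree_eq : ofFree K E = (mk K E).comp (LocGen.emb K E) := by
  ext e; simp [ofFree, LocGen.emb, ι]

variable {K E}

theorem mk_right {n : ℕ} (M : Matrix (Fin n) (Fin n) (FreeAlgebra K E)) (hM : IsFull M) :
    M.map (ofFree K E) * (LocGen.invMat K E M hM).map (mk K E) = 1 := by
  have h : ((M.map (LocGen.emb K E)) * LocGen.invMat K E M hM).map (mk K E) = 1 := by
    ext i j
    have := RingQuot.mkAlgHom_rel K (LocRel.right n M hM i j)
    rw [Matrix.map_apply]
    refine this.trans ?_
    change mk K E _ = _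
    by_cases hij : i = j <;> simp [Matrix.one_apply, hij]
  rw [← h, Matrix.map_mul, ofFree_eq]; rfl

theorem mk_left {n : ℕ} (M : Matrix (Fin n) (Fin n) (FreeAlgebra K E)) (hM : IsFull M) :
    (LocGen.invMat K E M hM).map (mk K E) * M.map (ofFree K E) = 1 := by
  have h : (LocGen.invMat K E M hM * (M.map (LocGen.emb K E))).map (mk K E) = 1 := by
    ext i j
    have := RingQuot.mkAlgHom_rel K (LocRel.left n M hM i j)
    rw [Matrix.map_apply]
    refine this.trans ?_
    change mk K E _ = _
    by_cases hij : i = j <;> simp [Matrix.one_apply, hij]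
  rw [← h, Matrix.map_mul, ofFree_eq]; rfl

/-- Homomorphisms from the free skew field are determined by the values at the indeterminates. -/
theorem hom_ext {B : Type*} [Ring B] [Algebra K B] {f g : FreeSkewField K E →ₐ[K] B}
    (h : ∀ e, f (ι K e) = g (ι K e)) : f = g := by
  have hfree : f.comp (ofFree K E) = g.comp (ofFree K E) := by
    ext e; simpa [ofFree] using h e
  refine RingQuot.ringQuot_ext' K f g (FreeAlgebra.hom_ext (funext fun x => ?_))
  cases x with
  | of e => exact h e
  | inv n M hM i j =>
    have h1 : (M.map (ofFree K E)).map f * ((LocGen.invMat K E M hM).map (mk K E)).map f = 1 := by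
      rw [← Matrix.map_mul, mk_right, Matrix.map_one _ (map_zero f) (map_one f)]
    have h2 : ((LocGen.invMat K E M hM).map (mk K E)).map g * (M.map (ofFree K E)).map g = 1 := by
      rw [← Matrix.map_mul, mk_left, Matrix.map_one _ (map_zero g) (map_one g)]
    have h3 : (M.map (ofFree K E)).map f = (M.map (ofFree K E)).map g := by
      ext i j; exact DFunLike.congr_fun hfree (M i j)
    rw [h3] at h1
    have h4 := left_inv_eq_right_inv h2 h1
    exact (congrFun (congrFun h4 i) j).symm

/-- A map to an algebra that makes every full matrix invertible extends to the free skew field. -/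
theorem exists_lift {B : Type*} [Ring B] [Algebra K B] (φ : E → B)
    (hφ : ∀ (n : ℕ) (M : Matrix (Fin n) (Fin n) (FreeAlgebra K E)), IsFull M →
      ∃ V : Matrix (Fin n) (Fin n) B,
        M.map (FreeAlgebra.lift K φ) * V = 1 ∧ V * M.map (FreeAlgebra.lift K φ) = 1) :
    ∃ f : FreeSkewField K E →ₐ[K] B, ∀ e, f (ι K e) = φ e := by
  choose V hV using hφ
  let ψ : LocGen K E → B := fun x => match x with
    | .of e => φ e
    | .inv n M hM i j => V n M hM i j
  have hemb : (FreeAlgebra.lift K ψ).comp (LocGen.emb K E) = FreeAlgebra.lift K φ := by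
    ext e; simp [LocGen.emb, ψ]
  have key1 : ∀ {n : ℕ} (M : Matrix (Fin n) (Fin n) (FreeAlgebra K E)),
      (M.map (LocGen.emb K E)).map (FreeAlgebra.lift K ψ) = M.map (FreeAlgebra.lift K φ) := by
    intro n M; rw [← hemb]; rfl
  have key2 : ∀ {n : ℕ} (M : Matrix (Fin n) (Fin n) (FreeAlgebra K E)) (hM : IsFull M),
      (LocGen.invMat K E M hM).map (FreeAlgebra.lift K ψ) = V n M hM := by
    intro n M hM; ext i j; simp [LocGen.invMat, ψ]
  have hrel : ∀ ⦃x y⦄, LocRel K E x y → FreeAlgebra.lift K ψ x = FreeAlgebra.lift K ψ y := by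
    intro x y hxy
    cases hxy with
    | right n M hM i j =>
      rw [← Matrix.map_apply (f := FreeAlgebra.lift K ψ), Matrix.map_mul, key1, key2,
        (hV n M hM).1, Matrix.one_apply, Matrix.one_apply]
      split_ifs <;> simp
    | left n M hM i j =>
      rw [← Matrix.map_apply (f := FreeAlgebra.lift K ψ), Matrix.map_mul, key1, key2,
        (hV n M hM).2, Matrix.one_apply, Matrix.one_apply]
      split_ifs <;> simp
  refine ⟨RingQuot.liftAlgHom K ⟨FreeAlgebra.lift K ψ, hrel⟩, fun e => ?_⟩
  exact (RingQuot.liftAlgHom_mkAlgHom_apply K _ _ _).trans (by simp [ψ])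

/-- Invertibility of matrices lifts along a surjection whose kernel has square zero. -/
theorem exists_inv_of_sq_zero {S T : Type*} [Ring S] [Ring T] (π : S →+* T)
    (hπ : Function.Surjective π) (hker : ∀ x y, π x = 0 → π y = 0 → x * y = 0) {n : ℕ}
    (M : Matrix (Fin n) (Fin n) S) (W : Matrix (Fin n) (Fin n) T)
    (h1 : M.map π * W = 1) (h2 : W * M.map π = 1) :
    ∃ V : Matrix (Fin n) (Fin n) S, M * V = 1 ∧ V * M = 1 := by
  have hsq : ∀ X : Matrix (Fin n) (Fin n) S, X.map π = 1 → (X - 1) * (X - 1) = 0 := by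
    intro X hX
    have h0 : ∀ i j, π ((X - 1) i j) = 0 := by
      intro i j
      have := congrFun (congrFun hX i) j
      rw [Matrix.map_apply] at this
      rw [Matrix.sub_apply, map_sub, this, Matrix.one_apply, Matrix.one_apply]
      split_ifs <;> simp
    ext i j
    rw [Matrix.mul_apply]
    exact Finset.sum_eq_zero fun k _ => hker _ _ (h0 i k) (h0 k j)
  choose s hs using hπ
  have hW : (W.map s).map π = W := by ext i j; simp [hs]
  have hr := hsq (M * W.map s) (by rw [Matrix.map_mul, hW, h1])
  have hl := hsq (W.map s * M) (by rw [Matrix.map_mul, hW, h2])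
  have hR : M * (W.map s * (2 - M * W.map s)) = 1 := by
    rw [← mul_assoc, ← sub_eq_zero, ← neg_eq_zero, ← hr]; noncomm_ring
  have hL : ((2 - W.map s * M) * W.map s) * M = 1 := by
    rw [mul_assoc, ← sub_eq_zero, ← neg_eq_zero, ← hl]; noncomm_ring
  exact ⟨_, hR, (left_inv_eq_right_inv hL hR) ▸ hL⟩

variable (K E) in
/-- Pairs of an upper triangular matrix with diagonal `x ⊗ 1`, `1 ⊗ x` and the element `x`. -/
def triangular : Subalgebra K
    (Matrix (Fin 2) (Fin 2) (FreeSkewField K E ⊗[K] FreeSkewField K E) × FreeSkewField K E) where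
  carrier := {x | x.1 0 0 = x.2 ⊗ₜ 1 ∧ x.1 1 1 = 1 ⊗ₜ x.2 ∧ x.1 1 0 = 0}
  mul_mem' := by
    rintro x y ⟨h1, h2, h3⟩ ⟨k1, k2, k3⟩
    simp [Matrix.mul_apply, Fin.sum_univ_two, h1, h2, h3, k1, k2, k3]
  add_mem' := by
    rintro x y ⟨h1, h2, h3⟩ ⟨k1, k2, k3⟩
    simp [h1, h2, h3, k1, k2, k3, TensorProduct.add_tmul, TensorProduct.tmul_add]
  algebraMap_mem' := by
    intro r
    simp [Algebra.algebraMap_eq_smul_one, Algebra.TensorProduct.one_def,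
      TensorProduct.smul_tmul']

/-- The conditions on a map `d : A → A ⊗ A` to be a derivation for the outer bimodule structure. -/
def IsOuterDer {A : Type*} [Ring A] [Algebra K A] (d : A →ₗ[K] A ⊗[K] A) : Prop :=
  ∀ x y, d (x * y) = d x * (1 ⊗ₜ[K] y) + (x ⊗ₜ[K] 1) * d y

/-- Derivations can be prescribed on the indeterminates. -/
theorem exists_der (P : E → FreeSkewField K E ⊗[K] FreeSkewField K E) :
    ∃ d : FreeSkewField K E →ₗ[K] FreeSkewField K E ⊗[K] FreeSkewField K E,
      IsOuterDer d ∧ ∀ e, d (ι K e) = P e := by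
  let φ : E → triangular K E := fun e =>
    ⟨(!![ι K e ⊗ₜ 1, P e; 0, 1 ⊗ₜ ι K e], ι K e), by simp [triangular]⟩
  let π : triangular K E →ₐ[K] FreeSkewField K E :=
    (AlgHom.snd K _ _).comp (triangular K E).val
  have hπ : Function.Surjective π := fun x =>
    ⟨⟨(!![x ⊗ₜ 1, 0; 0, 1 ⊗ₜ x], x), by simp [triangular]⟩, rfl⟩
  have hker : ∀ x y, π x = 0 → π y = 0 → x * y = 0 := by
    rintro ⟨⟨x1, x2⟩, h1, h2, h3⟩ ⟨⟨y1, y2⟩, k1, k2, k3⟩ hx hy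
    change x2 = 0 at hx
    change y2 = 0 at hy
    subst hx hy
    simp only [TensorProduct.zero_tmul, TensorProduct.tmul_zero] at h1 h2 h3 k1 k2 k3
    apply Subtype.ext
    refine Prod.ext ?_ (by simp)
    ext i j
    fin_cases i <;> fin_cases j <;> simp [Matrix.mul_apply, Fin.sum_univ_two, *]
  have hcomp : π.comp (FreeAlgebra.lift K φ) = ofFree K E := by
    ext e; simp [ofFree, φ, π]
  obtain ⟨f, hf⟩ := exists_lift φ fun n M hM => by
    have hM' : (M.map (FreeAlgebra.lift K φ)).map π = M.map (ofFree K E) := by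
      rw [← hcomp]; rfl
    exact exists_inv_of_sq_zero π.toRingHom hπ hker (M.map (FreeAlgebra.lift K φ))
      ((LocGen.invMat K E M hM).map (mk K E))
      ((congrArg (· * _) hM').trans (mk_right M hM)) ((congrArg (_ * ·) hM').trans (mk_left M hM))
  have hsnd : ∀ x, (f x).1.2 = x := by
    have : π.comp f = AlgHom.id K _ := hom_ext fun e => by simp [hf, π, φ]
    exact fun x => DFunLike.congr_fun this x
  let d : FreeSkewField K E →ₗ[K] FreeSkewField K E ⊗[K] FreeSkewField K E :=
    { toFun := fun x => (f x).1.1 0 1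
      map_add' := fun x y => by simp
      map_smul' := fun k x => by simp }
  refine ⟨d, fun x y => ?_, fun e => by simp [d, hf, φ]⟩
  have h1 : (f x).1.1 0 0 = (f x).1.2 ⊗ₜ 1 := (f x).2.1
  have h2 : (f y).1.1 1 1 = 1 ⊗ₜ (f y).1.2 := (f y).2.2.1
  change (f (x * y)).1.1 0 1 = (f x).1.1 0 1 * _ + _ * (f y).1.1 0 1
  rw [hsnd] at h1 h2
  rw [map_mul, ← h1, ← h2, add_comm]
  exact (Matrix.mul_apply).trans (Fin.sum_univ_two _)

/-- Derivations are determined by their values at the indeterminates. -/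
theorem der_ext {d d' : FreeSkewField K E →ₗ[K] FreeSkewField K E ⊗[K] FreeSkewField K E}
    (hd : IsOuterDer d) (hd' : IsOuterDer d') (h : ∀ e, d (ι K e) = d' (ι K e)) : d = d' := by
  let F : ∀ d : FreeSkewField K E →ₗ[K] FreeSkewField K E ⊗[K] FreeSkewField K E, IsOuterDer d →
      FreeSkewField K E →ₐ[K] Matrix (Fin 2) (Fin 2) (FreeSkewField K E ⊗[K] FreeSkewField K E) :=
    fun d hd => AlgHom.ofLinearMap
      { toFun := fun x => !![x ⊗ₜ 1, d x; 0, 1 ⊗ₜ x]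
        map_add' := fun x y => by
          ext i j; fin_cases i <;> fin_cases j <;>
            simp [TensorProduct.add_tmul, TensorProduct.tmul_add]
        map_smul' := fun k x => by
          ext i j; fin_cases i <;> fin_cases j <;> simp [TensorProduct.smul_tmul'] }
      (by
        have h1 : d 1 = 0 := by
          have := hd 1 1
          rw [← Algebra.TensorProduct.one_def, mul_one, one_mul, mul_one] at this
          simpa using this
        ext i j; fin_cases i <;> fin_cases j <;> simp [h1, Algebra.TensorProduct.one_def])
      (fun x y => by
        ext i j; fin_cases i <;> fin_cases j <;>
          simp [Matrix.mul_apply, Fin.sum_univ_two, hd x y, add_comm])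
  have hF : F d hd = F d' hd' := hom_ext fun e => by
    ext i j; fin_cases i <;> fin_cases j <;> simp [F, h e]
  ext x
  have := congrFun (congrFun (DFunLike.congr_fun hF x) 0) 1
  simpa [F] using this

variable (K E) in
/-- The bilinear operation `(u ⊗ v, m) ↦ (1 ⊗ u) m (v ⊗ 1)`. -/
noncomputable def innerAct : FreeSkewField K E ⊗[K] FreeSkewField K E →ₗ[K]
    Module.End K (FreeSkewField K E ⊗[K] FreeSkewField K E) :=
  TensorProduct.lift ((LinearMap.mul K (Module.End K _)).compl₁₂
    (LinearMap.mul K (FreeSkewField K E ⊗[K] FreeSkewField K E) ∘ₗ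
      Algebra.TensorProduct.includeRight.toLinearMap)
    ((LinearMap.mul K (FreeSkewField K E ⊗[K] FreeSkewField K E)).flip ∘ₗ
      Algebra.TensorProduct.includeLeft.toLinearMap))

theorem innerAct_tmul (u v : FreeSkewField K E) (m : FreeSkewField K E ⊗[K] FreeSkewField K E) :
    innerAct K E (u ⊗ₜ v) m = (1 ⊗ₜ[K] u) * (m * (v ⊗ₜ[K] 1)) := rfl

theorem innerAct_left (a : FreeSkewField K E) (w m : FreeSkewField K E ⊗[K] FreeSkewField K E) :
    innerAct K E ((a ⊗ₜ[K] 1) * w) m = (1 ⊗ₜ[K] a) * innerAct K E w m := by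
  induction w with
  | zero => simp
  | tmul u v => simp [innerAct_tmul, ← mul_assoc]
  | add x y hx hy => simp [mul_add, hx, hy]

theorem innerAct_right (b : FreeSkewField K E) (w m : FreeSkewField K E ⊗[K] FreeSkewField K E) :
    innerAct K E (w * (1 ⊗ₜ[K] b)) m = innerAct K E w m * (b ⊗ₜ[K] 1) := by
  induction w with
  | zero => simp
  | tmul u v => simp [innerAct_tmul, mul_assoc]
  | add x y hx hy => simp [add_mul, hx, hy]

theorem innerAct_mul_right (c : FreeSkewField K E)
    (w m : FreeSkewField K E ⊗[K] FreeSkewField K E) :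
    innerAct K E w (m * (1 ⊗ₜ[K] c)) = innerAct K E w m * (1 ⊗ₜ[K] c) := by
  induction w with
  | zero => simp
  | tmul u v => simp [innerAct_tmul, mul_assoc]
  | add x y hx hy => simp [add_mul, hx, hy]

theorem innerAct_mul_left (b : FreeSkewField K E)
    (w m : FreeSkewField K E ⊗[K] FreeSkewField K E) :
    innerAct K E w ((b ⊗ₜ[K] 1) * m) = (b ⊗ₜ[K] 1) * innerAct K E w m := by
  induction w with
  | zero => simp
  | tmul u v =>
    have : (1 ⊗ₜ[K] u) * (b ⊗ₜ[K] 1) = (b ⊗ₜ[K] 1) * (1 ⊗ₜ[K] u) := by simp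
    rw [innerAct_tmul, innerAct_tmul, ← mul_assoc, ← mul_assoc, ← mul_assoc, ← mul_assoc, this]
  | add x y hx hy => simp [mul_add, hx, hy]

theorem comm_mul (x y : FreeSkewField K E ⊗[K] FreeSkewField K E) :
    TensorProduct.comm K _ _ (x * y) = TensorProduct.comm K _ _ x * TensorProduct.comm K _ _ y :=
  map_mul (Algebra.TensorProduct.comm K (FreeSkewField K E) (FreeSkewField K E)) x y

/-- Values on pairs of indeterminates that are compatible with skew symmetry extend to exactly one
double bracket on the free skew field. -/
theorem existsUnique_bracket [Fintype E] (t : E → E → FreeSkewField K E ⊗[K] FreeSkewField K E)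
    (ht : ∀ e e', t e e' = -TensorProduct.comm K _ _ (t e' e)) :
    ∃! D : DoubleBracket K (FreeSkewField K E), ∀ e e', D.br (ι K e) (ι K e') = t e e' := by
  classical
  choose der hder hderι using
    fun e => exists_der (K := K) (Pi.single e (1 : FreeSkewField K E ⊗[K] FreeSkewField K E))
  choose D hD hDι using fun e => exists_der (K := K) (t e)
  let br : FreeSkewField K E →ₗ[K] FreeSkewField K E →ₗ[K]
      FreeSkewField K E ⊗[K] FreeSkewField K E :=
    ∑ e, (innerAct K E).compl₁₂ (der e) (D e)
  have br_apply : ∀ u v, br u v = ∑ e, innerAct K E (der e u) (D e v) := fun u v => by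
    simp [br, LinearMap.sum_apply]
  have leib : ∀ a b c, br a (b * c) = br a b * (1 ⊗ₜ[K] c) + (b ⊗ₜ[K] 1) * br a c := fun a b c => by
    simp only [br_apply, hD _ b c, map_add, innerAct_mul_left, innerAct_mul_right,
      Finset.sum_add_distrib, Finset.sum_mul, Finset.mul_sum]
  have leibL : ∀ a b c, br (a * b) c = br a c * (b ⊗ₜ[K] 1) + (1 ⊗ₜ[K] a) * br b c :=
    fun a b c => by
      simp only [br_apply, hder _ a b, map_add, LinearMap.add_apply, innerAct_left, innerAct_right,
        Finset.sum_add_distrib, Finset.sum_mul, Finset.mul_sum]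
  have gen : ∀ e v, br (ι K e) v = D e v := fun e v => by
    have h1 : ∀ m, innerAct K E 1 m = m := fun m => by
      rw [Algebra.TensorProduct.one_def, innerAct_tmul, ← Algebra.TensorProduct.one_def, mul_one,
        one_mul]
    rw [br_apply, Finset.sum_eq_single e]
    · rw [hderι, Pi.single_eq_same, h1]
    · intro b _ hb
      rw [hderι, Pi.single_eq_of_ne hb.symm]; simp
    · simp
  have flip : ∀ u, IsOuterDer (-((TensorProduct.comm K _ _).toLinearMap ∘ₗ br.flip u)) := by
    intro u x y
    simp [leibL, comm_mul, add_comm]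
  have skewGen : ∀ e u, br u (ι K e) = -TensorProduct.comm K _ _ (br (ι K e) u) := by
    intro e u
    have := der_ext (d := br (ι K e)) (fun x y => leib _ x y) (flip (ι K e)) fun e' => by
      simp [gen, hDι, ht e e']
    rw [DFunLike.congr_fun this u]
    simp
  have skew : ∀ a b, br a b = -TensorProduct.comm K _ _ (br b a) := by
    intro a b
    have := der_ext (d := br a) (fun x y => leib _ x y) (flip a) fun e' => by
      simp [skewGen e' a]
    exact DFunLike.congr_fun this b
  refine ⟨⟨br, skew, leib⟩, fun e e' => (gen e _).trans (hDι e e'), fun D' hD' => ?_⟩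
  have h1 : ∀ e, D'.br (ι K e) = br (ι K e) := fun e =>
    der_ext (fun x y => D'.leibniz _ x y) (fun x y => leib _ x y) fun e' => by
      rw [hD', gen, hDι]
  have h2 : D'.br = br := by
    ext1 u
    refine der_ext (fun x y => D'.leibniz _ x y) (fun x y => leib _ x y) fun e => ?_
    rw [D'.skew, skew, h1]
  exact DoubleBracket.eq_of_br h2

/-- The double bracket on the free skew field with prescribed values on the indeterminates. -/
noncomputable def extendBracket [Fintype E]
    (t : E → E → FreeSkewField K E ⊗[K] FreeSkewField K E)
    (ht : ∀ e e', t e e' = -TensorProduct.comm K _ _ (t e' e)) :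
    DoubleBracket K (FreeSkewField K E) :=
  (existsUnique_bracket t ht).choose

theorem extendBracket_ι [Fintype E] (t : E → E → FreeSkewField K E ⊗[K] FreeSkewField K E)
    (ht : ∀ e e', t e e' = -TensorProduct.comm K _ _ (t e' e)) (e e' : E) :
    (extendBracket t ht).br (ι K e) (ι K e') = t e e' :=
  (existsUnique_bracket t ht).choose_spec.1 e e'

end FreeSkewField
end FreeSkewField

/-! ## The network of `N` squares and its double bracket -/

/-- The names of the edges of the `i`-th square (`α` left, going up; `β` bottom; `γ` right, going
down; `δ` top) and of the edges `p`, `q` entering its upper left and leaving its upper right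
corner. -/
inductive EdgeKind
  | α | β | γ | δ | p | q
  deriving DecidableEq

instance : Fintype EdgeKind := ⟨{.α, .β, .γ, .δ, .p, .q}, by rintro ⟨⟩ <;> simp⟩

/-- The edges of the network of `N` squares, with its two sources glued to its two sinks. The
squares are numbered cyclically. -/
abbrev Edge (N : ℕ) : Type := EdgeKind × ZMod N

/-- The edges `(x, y, z)` at a white vertex: `x` incoming, `y` and `z` outgoing, counterclockwise.
`(false, i)` is the lower left and `(true, i)` the upper right corner of the `i`-th square. -/
def whiteVertex {N : ℕ} : Bool × ZMod N → Edge N × Edge N × Edge N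
  | (false, i) => ((.q, i - 1), (.β, i), (.α, i))
  | (true, i) => ((.δ, i), (.γ, i), (.q, i))

/-- The edges `(a, c, b)` at a black vertex: `a` outgoing, `c` and `b` incoming, counterclockwise.
`(false, i)` is the upper left and `(true, i)` the lower right corner of the `i`-th square. -/
def blackVertex {N : ℕ} : Bool × ZMod N → Edge N × Edge N × Edge N
  | (false, i) => ((.δ, i), (.p, i), (.α, i))
  | (true, i) => ((.p, i + 1), (.γ, i), (.β, i))

section Network

variable {K R : Type*} [Field K] [Ring R] [Algebra K R] {N : ℕ} [NeZero N]

variable (K) in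
/-- The sum over all vertices of the contributions `y ⊗ z` to `⦃y, z⦄` (white) and `c ⊗ b` to
`⦃b, c⦄` (black), where `w` is the edge weight. -/
def vertexSum (w : Edge N → R) (e e' : Edge N) : R ⊗[K] R :=
  ∑ v : Bool × ZMod N,
    ((if e = (whiteVertex v).2.1 ∧ e' = (whiteVertex v).2.2 then w e ⊗ₜ[K] w e' else 0) +
      (if e = (blackVertex v).2.2 ∧ e' = (blackVertex v).2.1 then w e' ⊗ₜ[K] w e else 0))

variable (K) in
/-- The double bracket of two edge weights: `⦃y, z⦄ = ½ y ⊗ z` at every white vertex,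
`⦃b, c⦄ = ½ c ⊗ b` at every black vertex, skew symmetry, and zero otherwise. -/
def edgeBracket (w : Edge N → R) (e e' : Edge N) : R ⊗[K] R :=
  (2⁻¹ : K) • (vertexSum K w e e' - TensorProduct.comm K R R (vertexSum K w e' e))

theorem edgeBracket_skew (w : Edge N → R) (e e' : Edge N) :
    edgeBracket K w e e' = -TensorProduct.comm K R R (edgeBracket K w e' e) := by
  simp only [edgeBracket, map_smul, map_sub, TensorProduct.comm_comm, ← smul_neg, neg_sub]

/-- `D` is a double bracket of the network with edge weights `w`. -/
def DoubleBracket.IsNetworkBracket (D : DoubleBracket K R) (w : Edge N → R) : Prop :=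
  ∀ e e', D.br (w e) (w e') = edgeBracket K w e e'

variable (K N) in
/-- The double bracket of the network on the free skew field on its edge weights. -/
noncomputable def networkBracket : DoubleBracket K (FreeSkewField K (Edge N)) :=
  FreeSkewField.extendBracket (edgeBracket K (FreeSkewField.ι K)) (edgeBracket_skew _)

/-! ## Gauge transformations, Postnikov moves and the leapfrog map -/

/-- The weights of the left, bottom, right and top edges of all squares, when all the other edges
have weight one. -/
structure SquareWeights (N : ℕ) (R : Type*) where
  a : ZMod N → R
  b : ZMod N → R
  c : ZMod N → R
  d : ZMod N → R

/-- The gauge transformation that makes the weights of all edges `p`, `q` equal to one. -/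
noncomputable def squareWeights (w : Edge N → R) : SquareWeights N R where
  a i := w (.α, i) * (w (.p, i))⁻¹ʳ
  b i := w (.β, i)
  c i := (w (.q, i))⁻¹ʳ * w (.γ, i)
  d i := w (.p, i) * w (.δ, i) * w (.q, i)

/-- Coordinates `X i`, `Y i` for `1 ≤ i ≤ N` (other indices are not used), and `Z`. -/
structure LoopWeights (R : Type*) where
  X : ℕ → R
  Y : ℕ → R
  Z : R

namespace SquareWeights

variable (s : SquareWeights N R)

/-- `z i = d 1 * c 1 * ⋯ * d (i - 1) * c (i - 1) * d i` for `i ≥ 1`. -/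
def z : ℕ → R
  | 0 => 0
  | 1 => s.d 1
  | i + 2 => z (i + 1) * s.c (i + 1 : ℕ) * s.d (i + 2 : ℕ)

/-- The weights after the gauge transformation that leaves only the left and bottom edges of the
squares and the last two edges with weights different from one. -/
noncomputable def loopWeights : LoopWeights R where
  X
    | 0 => 0
    | 1 => (s.c N)⁻¹ʳ * s.a 1
    | i + 2 => s.z (i + 1) * s.a (i + 2 : ℕ) * (s.c (i + 1 : ℕ))⁻¹ʳ * (s.z (i + 1))⁻¹ʳ
  Y
    | 0 => 0
    | 1 => (s.c N)⁻¹ʳ * s.b 1 * (s.c 1)⁻¹ʳ * (s.d 1)⁻¹ʳ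
    | i + 2 => s.z (i + 1) * s.b (i + 2 : ℕ) * (s.c (i + 2 : ℕ))⁻¹ʳ * (s.d (i + 2 : ℕ))⁻¹ʳ *
        (s.c (i + 1 : ℕ))⁻¹ʳ * (s.z (i + 1))⁻¹ʳ
  Z := s.z N * s.c N

/-- The weight `f = b + a d c` of the square move. -/
def f (i : ZMod N) : R := s.b i + s.a i * s.d i * s.c i

/-- The weights after the square move at every square. -/
noncomputable def postnikov : SquareWeights N R where
  a i := s.d i * s.c i * (s.f i)⁻¹ʳ
  b i := s.f i
  c i := (s.f i)⁻¹ʳ * s.a i * s.d i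
  d i := s.d i * s.c i * (s.f i)⁻¹ʳ * s.b i * (s.c i)⁻¹ʳ

/-- `ξ i = a 1 * b 1 * ⋯ * a i * b i`. -/
def ξ : ℕ → R
  | 0 => 1
  | i + 1 => ξ i * s.a (i + 1 : ℕ) * s.b (i + 1 : ℕ)

/-- The coordinates of the network obtained by the Postnikov moves (square moves and swaps), in
terms of the weights `s` after the square moves: now `c (i - 1)`, `d i`, `a (i + 1)`, `b i` are the
weights of the left, bottom, right and top edge of one square, and a gauge transformation again
leaves only left and bottom edges and the last two edges with weights different from one. -/
noncomputable def movedLoopWeights : LoopWeights R where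
  X
    | 0 => 0
    | i + 1 => s.ξ i * s.c (i : ℕ) * (s.a (i + 1 : ℕ))⁻¹ʳ * (s.ξ i)⁻¹ʳ
  Y
    | 0 => 0
    | i + 1 => s.ξ i * s.d (i + 1 : ℕ) * (s.a (i + 2 : ℕ))⁻¹ʳ * (s.b (i + 1 : ℕ))⁻¹ʳ *
        (s.a (i + 1 : ℕ))⁻¹ʳ * (s.ξ i)⁻¹ʳ
  Z := s.ξ N

end SquareWeights

/-- The twisted extension of a sequence `U 1, …, U N` by `U (i + N) = Z * U i * Z⁻¹` to the
indices `0` and `N + 1`. -/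
noncomputable def twist (N : ℕ) (Z : R) (U : ℕ → R) (i : ℕ) : R :=
  if i = 0 then Z⁻¹ʳ * U N * Z else if i = N + 1 then Z * U 1 * Z⁻¹ʳ else U i

/-- The non-commutative leapfrog map. -/
noncomputable def leapfrog (N : ℕ) (x : LoopWeights R) : LoopWeights R where
  X i := (twist N x.Z x.X (i - 1) + twist N x.Z x.Y (i - 1))⁻¹ʳ * twist N x.Z x.X (i - 1) *
    (twist N x.Z x.X i + twist N x.Z x.Y i)
  Y i := (twist N x.Z x.X i + twist N x.Z x.Y i)⁻¹ʳ * twist N x.Z x.Y i *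
    (twist N x.Z x.X (i + 1) + twist N x.Z x.Y (i + 1))
  Z := x.Z

/-- The bracket relations of the coordinates in the cyclic space. -/
structure DoubleBracket.SatisfiesRelations (D : DoubleBracket K R) (N : ℕ) (x : LoopWeights R) :
    Prop where
  X_X : ∀ i ∈ Finset.Icc 1 N, ∀ j ∈ Finset.Icc 1 N,
    D.cyclicBracket (cyc K (x.X i)) (cyc K (x.X j)) = 0
  Y_X : ∀ i ∈ Finset.Icc 1 N, ∀ j ∈ Finset.Icc 1 N,
    D.cyclicBracket (cyc K (x.Y i)) (cyc K (x.X j)) = cyc K (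
      (if i = j then x.Y i * x.X j else 0) - (if j = i + 1 then x.X j * x.Y i else 0) -
      (if j = 1 ∧ i = N then x.X 1 * x.Z⁻¹ʳ * x.Y N * x.Z else 0))
  Y_Y : ∀ i ∈ Finset.Icc 1 N, ∀ j ∈ Finset.Icc 1 N,
    D.cyclicBracket (cyc K (x.Y i)) (cyc K (x.Y j)) = cyc K (
      (if i = j + 1 then x.Y i * x.Y j else 0) - (if j = i + 1 then x.Y j * x.Y i else 0) +
      (if i = 1 ∧ j = N then x.Y 1 * x.Z⁻¹ʳ * x.Y N * x.Z else 0) -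
      (if j = 1 ∧ i = N then x.Y 1 * x.Z⁻¹ʳ * x.Y N * x.Z else 0))
  Z_X : ∀ i ∈ Finset.Icc 1 N, D.cyclicBracket (cyc K x.Z) (cyc K (x.X i)) = 0
  Z_Y : ∀ i ∈ Finset.Icc 1 N, D.cyclicBracket (cyc K x.Z) (cyc K (x.Y i)) = 0
  Z_Z : D.cyclicBracket (cyc K x.Z) (cyc K x.Z) = 0

/-- Two systems of coordinates agree (at the indices in use). -/
def LoopWeights.Agree (N : ℕ) (x y : LoopWeights R) : Prop :=
  (∀ i ∈ Finset.Icc 1 N, x.X i = y.X i ∧ x.Y i = y.Y i) ∧ x.Z = y.Z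

/-- The Postnikov moves realize the leapfrog map, and the bracket relations hold for the coordinates
of the network before and after the leapfrog map. -/
def DoubleBracket.LeapfrogInvariant (D : DoubleBracket K R) (w : Edge N → R) : Prop :=
  (squareWeights w).postnikov.movedLoopWeights.Agree N
      (leapfrog N (squareWeights w).loopWeights) ∧
    D.SatisfiesRelations N (squareWeights w).loopWeights ∧
    D.SatisfiesRelations N (leapfrog N (squareWeights w).loopWeights)

end Network

/-! ## The operations `x ⊗ y ↦ x m y` applied to a double bracket -/

/-! Up to conjugation, all coordinates are short loops at the vertices of one closed path. Put `u i
= d i * c i` and `P n = u 1 * ⋯ * u n`. Then `Z = P N`, while `X i` and `Y i` are the conjugates by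
`P (i - 1)` of the loops `x i = (c (i - 1))⁻¹ * a i` and `y i = (c (i - 1))⁻¹ * b i * (u i)⁻¹`,
based where `u i` begins. The cyclic space does not see conjugation, so the relations reduce to
brackets of short loops (`LoopBracket`). These are non-zero only at equal or neighbouring vertices;
the terms with `Z` come from the neighbours `N` and `1`. The bracket of a loop with `P N` telescopes
to a commutator or to zero, which gives the relations for `Z` (`LoopBracket.satisfiesRelations`).

The sum `x i + y i` is `(c (i - 1))⁻¹ * f i * (u i)⁻¹`. Inserting this into the leapfrog map gives
loops carried along the same path, and these are the loops formed from the weights after the square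
moves: there `u i` is the product of the new `a i` and `b i`, so neither the path nor `Z` changes.
This is the realization by Postnikov moves (`SquareWeights.isTransported_leapfrog`).

The square move carries the brackets of the square weights to brackets of a similar monomial form
(`SquareMoveBracket.movedSquareBracket`), and the new loops satisfy the same `LoopBracket` relations
as the old ones. One derivation of the relations therefore serves before and after the leapfrog map.
-/

section TwistedMultiplication

variable (K : Type*) {A : Type*} [Field K] [Ring A] [Algebra K A]

/-- The linear map `x ⊗ y ↦ x * m * y`. -/
noncomputable def mulThrough (m : A) : A ⊗[K] A →ₗ[K] A :=
  LinearMap.mul' K A ∘ₗ TensorProduct.map (LinearMap.mulRight K m) LinearMap.id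

@[simp]
theorem mulThrough_tmul (m x y : A) : mulThrough K m (x ⊗ₜ y) = x * m * y := rfl

theorem mulThrough_mul_tmul_one (m b : A) (t : A ⊗[K] A) :
    mulThrough K m (t * (b ⊗ₜ[K] 1)) = mulThrough K (b * m) t := by
  induction t with
  | zero => simp
  | tmul x y => simp [mul_assoc]
  | add x y hx hy => simp [add_mul, hx, hy]

theorem mulThrough_one_tmul_mul (m a : A) (t : A ⊗[K] A) :
    mulThrough K m ((1 ⊗ₜ[K] a) * t) = mulThrough K (m * a) t := by
  induction t with
  | zero => simp
  | tmul x y => simp [mul_assoc]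
  | add x y hx hy => simp [mul_add, hx, hy]

theorem mulThrough_mul_one_tmul (m b : A) (t : A ⊗[K] A) :
    mulThrough K m (t * (1 ⊗ₜ[K] b)) = mulThrough K m t * b := by
  induction t with
  | zero => simp
  | tmul x y => simp [mul_assoc]
  | add x y hx hy => simp [add_mul, hx, hy]

theorem mulThrough_tmul_one_mul (m a : A) (t : A ⊗[K] A) :
    mulThrough K m ((a ⊗ₜ[K] 1) * t) = a * mulThrough K m t := by
  induction t with
  | zero => simp
  | tmul x y => simp [mul_assoc]
  | add x y hx hy => simp [mul_add, hx, hy]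

end TwistedMultiplication

/-! ### Leibniz rules with a parameter in the middle. -/

namespace DoubleBracket

variable {K A : Type*} [Field K] [Ring A] [Algebra K A] (D : DoubleBracket K A)

/-- Skew symmetry moves the product into the second argument; the flip turns the outer factors of
the Leibniz rule into inner ones. -/
theorem leibniz_left (a b c : A) :
    D.br (a * b) c = D.br a c * (b ⊗ₜ[K] 1) + (1 ⊗ₜ[K] a) * D.br b c := by
  have comm_mul : ∀ x y : A ⊗[K] A, TensorProduct.comm K A A (x * y) =
      TensorProduct.comm K A A x * TensorProduct.comm K A A y :=
    map_mul (Algebra.TensorProduct.comm K A A)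
  rw [D.skew (a * b), D.leibniz, map_add, comm_mul, comm_mul, D.skew a c, D.skew b c]
  simp [add_comm]

/-- The operation `x ⊗ y ↦ x * m * y` applied to `⦃a, b⦄`. -/
noncomputable def indThrough (m a b : A) : A := mulThrough K m (D.br a b)

theorem ind_eq_indThrough (a b : A) : D.ind a b = D.indThrough 1 a b := by
  rw [ind_apply, indThrough, mulThrough, LinearMap.comp_apply]
  simp

/-- The inner factors are absorbed by the parameter `m`. With `m` arbitrary, brackets of words can
thus be expanded in both arguments inside `A`, without tensors; `ind` alone is not closed under this
expansion. -/
theorem indThrough_mul_left (m a b c : A) :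
    D.indThrough m (a * b) c = D.indThrough (b * m) a c + D.indThrough (m * a) b c := by
  simp only [indThrough, leibniz_left, map_add, mulThrough_mul_tmul_one, mulThrough_one_tmul_mul]

theorem indThrough_mul_right (m a b c : A) :
    D.indThrough m a (b * c) = D.indThrough m a b * c + b * D.indThrough m a c := by
  simp only [indThrough, leibniz, map_add, mulThrough_mul_one_tmul, mulThrough_tmul_one_mul]

theorem indThrough_add_left (m a b c : A) :
    D.indThrough m (a + b) c = D.indThrough m a c + D.indThrough m b c := by
  simp [indThrough]

theorem indThrough_add_right (m a b c : A) :
    D.indThrough m a (b + c) = D.indThrough m a b + D.indThrough m a c := by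
  simp [indThrough]

theorem indThrough_sub_left (m a b c : A) :
    D.indThrough m (a - b) c = D.indThrough m a c - D.indThrough m b c := by
  simp [indThrough]

theorem indThrough_sub_right (m a b c : A) :
    D.indThrough m a (b - c) = D.indThrough m a b - D.indThrough m a c := by
  simp [indThrough]

theorem indThrough_one_right (m a : A) : D.indThrough m a 1 = 0 := by
  simpa using D.indThrough_mul_right m a 1 1

theorem indThrough_one_left (m a : A) : D.indThrough m 1 a = 0 := by
  simpa using D.indThrough_mul_left m 1 1 a

theorem indThrough_inv_right (m a : A) (b : Aˣ) :
    D.indThrough m a ↑b⁻¹ = -(↑b⁻¹ * D.indThrough m a b * ↑b⁻¹) := by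
  -- The Leibniz rule is applied to `b⁻¹ * b = 1`, whose bracket vanishes.
  have h := D.indThrough_mul_right m a (↑b⁻¹) b
  rw [Units.inv_mul, indThrough_one_right] at h
  rw [eq_neg_iff_add_eq_zero, ← Units.mul_left_eq_zero b, add_mul, h]
  simp

theorem indThrough_inv_left (m c : A) (a : Aˣ) :
    D.indThrough m ↑a⁻¹ c = -D.indThrough (↑a⁻¹ * m * ↑a⁻¹) a c := by
  -- The parameter `m * a⁻¹` is chosen so that the factor `a` it receives from the left Leibniz rule
  -- cancels, leaving `m`.
  have h := D.indThrough_mul_left (m * ↑a⁻¹) a (↑a⁻¹) c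
  rw [Units.mul_inv, indThrough_one_left] at h
  rw [eq_neg_iff_add_eq_zero, h, add_comm]
  simp [mul_assoc]

end DoubleBracket

/-! ## The brackets of the weights of a square, and the square move -/

section SquareMove

variable {K A I : Type*} [Field K] [Ring A] [Algebra K A] [DecidableEq I]

/-- The brackets `⦃b, a⦄ = h b ⊗ a`, `⦃b, c⦄ = h c ⊗ b`, `⦃a, d⦄ = h 1 ⊗ a d` and `⦃c, d⦄ = h d c ⊗ 1`
of the weights of a square, all others being zero, in terms of `indThrough`. -/
structure SquareBracket (D : DoubleBracket K A) (h : K) (a b c d : I → Aˣ) : Prop where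
  a_a : ∀ m i j, D.indThrough m (a i) (a j) = 0
  a_b : ∀ m i j, D.indThrough m (a i) (b j) = if i = j then h • (-(a i * m * b j) : A) else 0
  a_c : ∀ m i j, D.indThrough m (a i) (c j) = 0
  a_d : ∀ m i j, D.indThrough m (a i) (d j) = if i = j then h • (m * a i * d i : A) else 0
  b_a : ∀ m i j, D.indThrough m (b i) (a j) = if i = j then h • (b i * m * a j : A) else 0
  b_b : ∀ m i j, D.indThrough m (b i) (b j) = 0
  b_c : ∀ m i j, D.indThrough m (b i) (c j) = if i = j then h • (c i * m * b j : A) else 0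
  b_d : ∀ m i j, D.indThrough m (b i) (d j) = 0
  c_a : ∀ m i j, D.indThrough m (c i) (a j) = 0
  c_b : ∀ m i j, D.indThrough m (c i) (b j) = if i = j then h • (-(b i * m * c j) : A) else 0
  c_c : ∀ m i j, D.indThrough m (c i) (c j) = 0
  c_d : ∀ m i j, D.indThrough m (c i) (d j) = if i = j then h • (d i * c i * m : A) else 0
  d_a : ∀ m i j, D.indThrough m (d i) (a j) = if i = j then h • (-(a i * d i * m) : A) else 0
  d_b : ∀ m i j, D.indThrough m (d i) (b j) = 0
  d_c : ∀ m i j, D.indThrough m (d i) (c j) = if i = j then h • (-(m * d i * c i) : A) else 0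
  d_d : ∀ m i j, D.indThrough m (d i) (d j) = 0

/-- The brackets `⦃b, a⦄ = h a b ⊗ 1`, `⦃b, c⦄ = h 1 ⊗ b c`, `⦃a, d⦄ = h a ⊗ d` and `⦃c, d⦄ = h d ⊗ c`, all
others being zero, in terms of `indThrough`. -/
structure MovedSquareBracket (D : DoubleBracket K A) (h : K) (a b c d : I → Aˣ) : Prop where
  a_a : ∀ m i j, D.indThrough m (a i) (a j) = 0
  a_b : ∀ m i j, D.indThrough m (a i) (b j) = if i = j then h • (-(m * a i * b i) : A) else 0
  a_c : ∀ m i j, D.indThrough m (a i) (c j) = 0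
  a_d : ∀ m i j, D.indThrough m (a i) (d j) = if i = j then h • (a i * m * d j : A) else 0
  b_a : ∀ m i j, D.indThrough m (b i) (a j) = if i = j then h • (a i * b i * m : A) else 0
  b_b : ∀ m i j, D.indThrough m (b i) (b j) = 0
  b_c : ∀ m i j, D.indThrough m (b i) (c j) = if i = j then h • (m * b i * c i : A) else 0
  b_d : ∀ m i j, D.indThrough m (b i) (d j) = 0
  c_a : ∀ m i j, D.indThrough m (c i) (a j) = 0
  c_b : ∀ m i j, D.indThrough m (c i) (b j) = if i = j then h • (-(b i * c i * m) : A) else 0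
  c_c : ∀ m i j, D.indThrough m (c i) (c j) = 0
  c_d : ∀ m i j, D.indThrough m (c i) (d j) = if i = j then h • (d i * m * c j : A) else 0
  d_a : ∀ m i j, D.indThrough m (d i) (a j) = if i = j then h • (-(d i * m * a j) : A) else 0
  d_b : ∀ m i j, D.indThrough m (d i) (b j) = 0
  d_c : ∀ m i j, D.indThrough m (d i) (c j) = if i = j then h • (-(c i * m * d j) : A) else 0
  d_d : ∀ m i j, D.indThrough m (d i) (d j) = 0

/-- The brackets of `u = d c`, `v = a d`, `f = b + a d c` and `d` for the weights of a square, in terms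
of `indThrough`. -/
structure SquareMoveBracket (D : DoubleBracket K A) (h : K) (u v f d : I → Aˣ) : Prop where
  u_u : ∀ m i j, D.indThrough m (u i) (u j) = 0
  u_v : ∀ m i j, D.indThrough m (u i) (v j) = 0
  u_f : ∀ m i j, D.indThrough m (u i) (f j) = if i = j then h • (-(f i * m * u j) : A) else 0
  u_d : ∀ m i j, D.indThrough m (u i) (d j) = if i = j then h • (u i * m * d j : A) else 0
  v_u : ∀ m i j, D.indThrough m (v i) (u j) = 0
  v_v : ∀ m i j, D.indThrough m (v i) (v j) = 0
  v_f : ∀ m i j, D.indThrough m (v i) (f j) = if i = j then h • (-(v i * m * f j) : A) else 0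
  v_d : ∀ m i j, D.indThrough m (v i) (d j) = if i = j then h • (d i * m * v j : A) else 0
  f_u : ∀ m i j, D.indThrough m (f i) (u j) = if i = j then h • (u i * m * f j : A) else 0
  f_v : ∀ m i j, D.indThrough m (f i) (v j) = if i = j then h • (f i * m * v j : A) else 0
  f_f : ∀ m i j, D.indThrough m (f i) (f j) = 0
  f_d : ∀ m i j, D.indThrough m (f i) (d j) = if i = j then h • (2 * (u i * m * v j) : A) else 0
  d_u : ∀ m i j, D.indThrough m (d i) (u j) = if i = j then h • (-(d i * m * u j) : A) else 0
  d_v : ∀ m i j, D.indThrough m (d i) (v j) = if i = j then h • (-(v i * m * d j) : A) else 0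
  d_f : ∀ m i j, D.indThrough m (d i) (f j) = if i = j then h • (-(2 * (v i * m * u j)) : A) else 0
  d_d : ∀ m i j, D.indThrough m (d i) (d j) = 0

variable {D : DoubleBracket K A} {h : K}

open DoubleBracket

/-- The new weights are expressed through `u`, `v`, `f`, `d` alone, so these form a convenient
halfway stage: expanding the sum `f` once here leaves a single monomial in every bracket. -/
theorem SquareBracket.squareMoveBracket {a b c d f : I → Aˣ} (hs : SquareBracket D h a b c d)
    (hf : ∀ i, (f i : A) = b i + a i * d i * c i) :
    SquareMoveBracket D h (fun i => d i * c i) (fun i => a i * d i) f d := by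
  cases hs
  constructor <;> intro m i j <;> rcases eq_or_ne i j with rfl | hij
  -- Expansion to right-associated words leaves an identity between linear combinations of words,
  -- which `module` checks with the words as atoms.
  all_goals
    simp only [*, Units.val_mul, indThrough_mul_left, indThrough_mul_right, indThrough_add_left,
      indThrough_add_right, if_true, if_false, mul_add, add_mul, mul_neg, neg_mul, mul_smul_comm,
      smul_mul_assoc, two_mul, mul_zero, zero_mul, mul_assoc]
    try module

/-- The correction term in `e` restores the simple form: for instance the bracket of `f` with `u *
f⁻¹ * v` is `2 * h` times `u ⊗ v`, which cancels the bracket of `f` with `d`. -/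
theorem SquareMoveBracket.movedSquareBracket {u v f d e : I → Aˣ}
    (hs : SquareMoveBracket D h u v f d) (he : ∀ i, (e i : A) = d i - u i * ↑(f i)⁻¹ * v i) :
    MovedSquareBracket D h (fun i => u i * (f i)⁻¹) f (fun i => (f i)⁻¹ * v i) e := by
  cases hs
  constructor <;> intro m i j <;> rcases eq_or_ne i j with rfl | hij
  all_goals
    simp only [*, Units.val_mul, indThrough_mul_left, indThrough_mul_right, indThrough_sub_left,
      indThrough_sub_right, indThrough_inv_left, indThrough_inv_right, if_true, if_false, mul_add,
      add_mul, mul_sub, sub_mul, mul_neg, neg_mul, mul_smul_comm, smul_mul_assoc, two_mul,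
      mul_zero, zero_mul, mul_assoc, Units.mul_inv_cancel_left, Units.inv_mul_cancel_left,
      Units.mul_inv, Units.inv_mul, mul_one]
    try module

end SquareMove

/-! ## Loops at the ends of a cyclic sequence of paths -/

section LoopBracket

variable {K A I : Type*} [Field K] [Ring A] [Algebra K A] [DecidableEq I]

open DoubleBracket

/-- The brackets of loops `x i`, `y i` based at the source of the path `u i`, where `σ` is the cyclic
order of the paths. A loop acts on the paths that begin or end at one vertex, the end of `u t`. -/
structure LoopBracket (D : DoubleBracket K A) (σ : Equiv.Perm I) (x y : I → A) (u : I → Aˣ) :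
    Prop where
  x_x : ∀ i j, D.ind (x i) (x j) = 0
  x_y : ∀ i j, cyc K (D.ind (x j) (y i)) =
    (if j = σ i then cyc K (x j * ↑(u i)⁻¹ * y i * u i) else 0) -
      if i = j then cyc K (y i * x j) else 0
  y_y : ∀ i j, cyc K (D.ind (y i) (y j)) =
    (if i = σ j then cyc K (y i * ↑(u j)⁻¹ * y j * u j) else 0) -
      if j = σ i then cyc K (y j * ↑(u i)⁻¹ * y i * u i) else 0
  x_u : ∀ i, ∃ (v : A) (t : I), ∀ k, D.ind (x i) (u k) =
    (if k = σ t then v * u k else 0) - if k = t then u k * v else 0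
  y_u : ∀ i, ∃ (v : A) (t : I), ∀ k, D.ind (y i) (u k) =
    (if k = σ t then v * u k else 0) - if k = t then u k * v else 0
  u_u : ∀ m i j, D.indThrough m (u i) (u j) = 0

variable {D : DoubleBracket K A} {h : K} {a b c d : I → Aˣ}

/-- This is where the coefficient one half disappears: the two halves of a bracket are different
words that become equal in the cyclic space. -/
theorem cyc_smul_add (hh : h + h = 1) {p q r : A} (hp : cyc K p = cyc K r)
    (hq : cyc K q = cyc K r) : cyc K (h • (p + q)) = cyc K r := by
  rw [map_smul, map_add, hp, hq, ← two_smul K, smul_smul, mul_two, hh, one_smul]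

theorem cyc_ite_sub_ite (hh : h + h = 1) {P P' Q Q' : Prop} [Decidable P] [Decidable P']
    [Decidable Q] [Decidable Q'] {p p' q q' r s : A} (hP : P ↔ P') (hQ : Q ↔ Q')
    (hp : cyc K p = cyc K r) (hp' : cyc K p' = cyc K r)
    (hq : cyc K q = cyc K s) (hq' : cyc K q' = cyc K s) :
    cyc K ((if P then h • (p + p') else 0) - if Q then h • (q + q') else 0) =
      (if P' then cyc K r else 0) - if Q' then cyc K s else 0 := by
  rw [map_sub, apply_ite (cyc K), apply_ite (cyc K), cyc_smul_add hh hp hp',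
    cyc_smul_add hh hq hq', map_zero]
  simp only [hP, hQ]

theorem cyc_rotate (p q r s : A) : cyc K (p * q * r * s) = cyc K (r * s * p * q) := by
  simpa only [mul_assoc] using cyc_mul_comm K (p * q) (r * s)


/-! ### Loops formed from the weights before the square moves. -/

section SquareBracket

set_option linter.unusedSimpArgs false
set_option linter.unnecessarySeqFocus false

variable {x y : I → I → Aˣ} {u : I → Aˣ} (hs : SquareBracket D h a b c d)
  (hx : ∀ i i', x i i' = (c i')⁻¹ * a i) (hy : ∀ i i', y i i' = (c i')⁻¹ * b i * (u i)⁻¹)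
  (hu : ∀ i, u i = d i * c i)

include hs

include hu in
theorem SquareBracket.indThrough_u_u (m : A) (i j : I) : D.indThrough m (u i) (u j) = 0 := by
  cases hs
  rcases eq_or_ne i j with rfl | h1 <;>
    simp [*, ind_eq_indThrough, mul_assoc, mul_add, add_mul, indThrough_mul_left,
      indThrough_mul_right, indThrough_inv_left, indThrough_inv_right]

include hx in
theorem SquareBracket.ind_x_x (i i' j j' : I) : D.ind (x i i') (x j j') = 0 := by
  cases hs
  simp [*, ind_eq_indThrough, mul_assoc, mul_add, add_mul, indThrough_mul_left,
      indThrough_mul_right, indThrough_inv_left, indThrough_inv_right]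

-- The index `i'` will be the predecessor of `i`. It is kept independent so that the case split
-- covers `i' = i` too, which occurs when there is only one square.
include hx hu in
theorem SquareBracket.ind_x_u (i i' k : I) : D.ind (x i i') (u k) =
    (if k = i then (h • (x i i' : A)) * u k else 0) -
      if k = i' then u k * (h • (x i i' : A)) else 0 := by
  cases hs
  rcases eq_or_ne k i with rfl | h1 <;> rcases eq_or_ne k i' with rfl | h2 <;>
    (try have h3 := h1.symm) <;> (try have h4 := h2.symm) <;>
    simp [*, ind_eq_indThrough, mul_assoc, mul_add, add_mul, indThrough_mul_left,
      indThrough_mul_right, indThrough_inv_left, indThrough_inv_right] <;>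
    module

include hy hu in
theorem SquareBracket.ind_y_u (i i' k : I) : D.ind (y i i') (u k) =
    (if k = i then (h • (y i i' : A)) * u k else 0) -
      if k = i' then u k * (h • (y i i' : A)) else 0 := by
  cases hs
  rcases eq_or_ne k i with rfl | h1 <;> rcases eq_or_ne k i' with rfl | h2 <;>
    (try have h3 := h1.symm) <;> (try have h4 := h2.symm) <;>
    simp [*, ind_eq_indThrough, mul_assoc, mul_add, add_mul, indThrough_mul_left,
      indThrough_mul_right, indThrough_inv_left, indThrough_inv_right] <;>
    module

-- All that is needed of the predecessors `i'` and `j'` is that they depend only on `i` and `j`;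
-- this is `hij`.
include hx hy hu in
theorem SquareBracket.ind_x_y {i i' j j' : I} (hij : i = j → i' = j') :
    D.ind (x j j') (y i i') =
      (if i = j' then h • (y i i' * u i * x j j' * ↑(u i)⁻¹ +
        y i i' * u i * x j j' * ↑(u i)⁻¹ : A) else 0) -
      if i = j then h • (x j j' * y i i' + y i i' * x j j' : A) else 0 := by
  cases hs
  rcases eq_or_ne i j with rfl | h1
  · obtain rfl := hij rfl
    rcases eq_or_ne i i' with rfl | h2 <;> (try have h3 := h2.symm) <;>
    simp [*, ind_eq_indThrough, mul_assoc, mul_add, add_mul, indThrough_mul_left,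
      indThrough_mul_right, indThrough_inv_left, indThrough_inv_right] <;>
    try module
  · have h3 := h1.symm
    clear hij
    rcases eq_or_ne i j' with rfl | h2 <;> (try have h4 := h2.symm) <;>
    simp [*, ind_eq_indThrough, mul_assoc, mul_add, add_mul, indThrough_mul_left,
      indThrough_mul_right, indThrough_inv_left, indThrough_inv_right]

include hy hu in
theorem SquareBracket.ind_y_y (i i' j j' : I) : D.ind (y i i') (y j j') =
      (if j = i' then h • (y j j' * u j * y i i' * ↑(u j)⁻¹ +
        y j j' * u j * y i i' * ↑(u j)⁻¹ : A) else 0) -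
      if i = j' then h • (↑(u i)⁻¹ * y i i' * u i * y j j' +
        ↑(u i)⁻¹ * y i i' * u i * y j j' : A) else 0 := by
  cases hs
  rcases eq_or_ne i j with rfl | h1
  · rcases eq_or_ne i i' with rfl | h2 <;> rcases eq_or_ne i j' with rfl | h3 <;>
    (try have h4 := h2.symm) <;> (try have h5 := h3.symm) <;>
    simp [*, ind_eq_indThrough, mul_assoc, mul_add, add_mul, indThrough_mul_left,
      indThrough_mul_right, indThrough_inv_left, indThrough_inv_right] <;>
    try module
  · have h2 := h1.symm
    rcases eq_or_ne j i' with rfl | h3 <;> rcases eq_or_ne i j' with rfl | h4 <;>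
    (try have h5 := h3.symm) <;> (try have h6 := h4.symm) <;>
    simp [*, ind_eq_indThrough, mul_assoc, mul_add, add_mul, indThrough_mul_left,
      indThrough_mul_right, indThrough_inv_left, indThrough_inv_right] <;>
    try module

include hx hy hu in
theorem SquareBracket.loopBracket (σ : Equiv.Perm I) (hh : h + h = 1) :
    LoopBracket D σ (fun i => x i (σ.symm i)) (fun i => y i (σ.symm i)) u where
  x_x i j := hs.ind_x_x hx ..
  x_y i j := by
    rw [hs.ind_x_y hx hy hu (by rintro rfl; rfl)]
    -- The words of each pair agree after a cyclic rotation; the open goal only rewrites the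
    -- neighbour condition in terms of `σ` instead of its inverse.
    refine cyc_ite_sub_ite hh ?_ Iff.rfl (cyc_rotate ..) (cyc_rotate ..) (cyc_mul_comm ..) rfl
    rw [Equiv.eq_symm_apply, eq_comm]
  y_y i j := by
    rw [hs.ind_y_y hy hu]
    refine cyc_ite_sub_ite hh ?_ ?_ (cyc_rotate ..) (cyc_rotate ..) ?_ ?_
    · rw [Equiv.eq_symm_apply, eq_comm]
    · rw [Equiv.eq_symm_apply, eq_comm]
    · rw [cyc_mul_comm]; simp only [mul_assoc]
    · rw [cyc_mul_comm]; simp only [mul_assoc]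
  x_u i := ⟨_, σ.symm i, fun k => by rw [hs.ind_x_u hx hu, σ.apply_symm_apply]⟩
  y_u i := ⟨_, σ.symm i, fun k => by rw [hs.ind_y_u hy hu, σ.apply_symm_apply]⟩
  u_u := hs.indThrough_u_u hu

end SquareBracket

/-! ### Loops formed from the weights after the square moves. -/

section MovedSquareBracket

set_option linter.unusedSimpArgs false
set_option linter.unnecessarySeqFocus false

variable {x y : I → I → Aˣ} {u : I → Aˣ} (hs : MovedSquareBracket D h a b c d)
  (hx : ∀ i i', x i i' = c i' * (a i)⁻¹) (hy : ∀ i i', y i i' = d i * (a i')⁻¹ * (u i)⁻¹)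
  (hu : ∀ i, u i = a i * b i)

include hs

include hu in
theorem MovedSquareBracket.indThrough_u_u (m : A) (i j : I) : D.indThrough m (u i) (u j) = 0 := by
  cases hs
  rcases eq_or_ne i j with rfl | h1 <;>
    simp [*, ind_eq_indThrough, mul_assoc, mul_add, add_mul, indThrough_mul_left,
      indThrough_mul_right, indThrough_inv_left, indThrough_inv_right]

include hx in
theorem MovedSquareBracket.ind_x_x (i i' j j' : I) : D.ind (x i i') (x j j') = 0 := by
  cases hs
  simp [*, ind_eq_indThrough, mul_assoc, mul_add, add_mul, indThrough_mul_left,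
      indThrough_mul_right, indThrough_inv_left, indThrough_inv_right]

include hx hu in
theorem MovedSquareBracket.ind_x_u (i i' k : I) : D.ind (x i i') (u k) =
    (if k = i then (h • (x i i' : A)) * u k else 0) -
      if k = i' then u k * (h • (x i i' : A)) else 0 := by
  cases hs
  rcases eq_or_ne k i with rfl | h1 <;> rcases eq_or_ne k i' with rfl | h2 <;>
    (try have h3 := h1.symm) <;> (try have h4 := h2.symm) <;>
    simp [*, ind_eq_indThrough, mul_assoc, mul_add, add_mul, indThrough_mul_left,
      indThrough_mul_right, indThrough_inv_left, indThrough_inv_right] <;>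
    module

-- For `y` the index `i'` will now be the successor of `i`. The loop acts on paths at the end of `u
-- i`, hence through its conjugate by `u i`.
include hy hu in
theorem MovedSquareBracket.ind_y_u (i i' k : I) : D.ind (y i i') (u k) =
    (if k = i' then (h • (↑(u i)⁻¹ * y i i' * u i : A)) * u k else 0) -
      if k = i then u k * (h • (↑(u i)⁻¹ * y i i' * u i : A)) else 0 := by
  cases hs
  rcases eq_or_ne k i with rfl | h1 <;> rcases eq_or_ne k i' with rfl | h2 <;>
    (try have h3 := h1.symm) <;> (try have h4 := h2.symm) <;>
    simp [*, ind_eq_indThrough, mul_assoc, mul_add, add_mul, indThrough_mul_left,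
      indThrough_mul_right, indThrough_inv_left, indThrough_inv_right] <;>
    module

-- In use `j'` precedes `j` and `i'` follows `i`; `hij` records that the successor of the
-- predecessor of `j` is `j`.
include hx hy hu in
theorem MovedSquareBracket.ind_x_y {i i' j j' : I} (hij : i = j' → i' = j) :
    D.ind (x j j') (y i i') =
      (if i = j' then h • (y i i' * u i * x j j' * ↑(u i)⁻¹ +
        y i i' * u i * x j j' * ↑(u i)⁻¹ : A) else 0) -
      if i = j then h • (x j j' * y i i' + y i i' * x j j' : A) else 0 := by
  cases hs
  rcases eq_or_ne i j' with rfl | h1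
  · obtain rfl := hij rfl
    rcases eq_or_ne i i' with rfl | h2 <;> (try have h3 := h2.symm) <;>
    simp [*, ind_eq_indThrough, mul_assoc, mul_add, add_mul, indThrough_mul_left,
      indThrough_mul_right, indThrough_inv_left, indThrough_inv_right] <;>
    try module
  · have h3 := h1.symm
    clear hij
    rcases eq_or_ne i j with rfl | h2 <;> (try have h4 := h2.symm) <;>
    simp [*, ind_eq_indThrough, mul_assoc, mul_add, add_mul, indThrough_mul_left,
      indThrough_mul_right, indThrough_inv_left, indThrough_inv_right] <;>
    try module

include hy hu in
theorem MovedSquareBracket.ind_y_y {i i' j j' : I} (hij : i = j → i' = j') :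
    D.ind (y i i') (y j j') =
      (if i = j' then h • (y j j' * u j * y i i' * ↑(u j)⁻¹ +
        y j j' * u j * y i i' * ↑(u j)⁻¹ : A) else 0) -
      if j = i' then h • (↑(u i)⁻¹ * y i i' * u i * y j j' +
        y j j' * (↑(u i)⁻¹ * y i i' * u i) : A) else 0 := by
  cases hs
  rcases eq_or_ne i j with rfl | h1
  · obtain rfl := hij rfl
    rcases eq_or_ne i i' with rfl | h2 <;> (try have h3 := h2.symm) <;>
    simp [*, ind_eq_indThrough, mul_assoc, mul_add, add_mul, indThrough_mul_left,
      indThrough_mul_right, indThrough_inv_left, indThrough_inv_right] <;>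
    try module
  · have h2 := h1.symm
    clear hij
    rcases eq_or_ne j i' with rfl | h3 <;> rcases eq_or_ne i j' with rfl | h4 <;>
    (try have h5 := h3.symm) <;> (try have h6 := h4.symm) <;>
    simp [*, ind_eq_indThrough, mul_assoc, mul_add, add_mul, indThrough_mul_left,
      indThrough_mul_right, indThrough_inv_left, indThrough_inv_right] <;>
    try module

include hx hy hu in
theorem MovedSquareBracket.loopBracket (σ : Equiv.Perm I) (hh : h + h = 1) :
    LoopBracket D σ (fun i => x i (σ.symm i)) (fun i => y i (σ i)) u where
  x_x i j := hs.ind_x_x hx ..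
  x_y i j := by
    rw [hs.ind_x_y hx hy hu (by rintro rfl; simp)]
    refine cyc_ite_sub_ite hh ?_ Iff.rfl (cyc_rotate ..) (cyc_rotate ..) (cyc_mul_comm ..) rfl
    rw [Equiv.eq_symm_apply, eq_comm]
  y_y i j := by
    rw [hs.ind_y_y hy hu (by rintro rfl; rfl)]
    refine cyc_ite_sub_ite hh Iff.rfl Iff.rfl (cyc_rotate ..) (cyc_rotate ..) ?_ ?_
    · rw [cyc_mul_comm]; simp only [mul_assoc]
    · simp only [mul_assoc]
  x_u i := ⟨_, σ.symm i, fun k => by rw [hs.ind_x_u hx hu, σ.apply_symm_apply]⟩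
  y_u i := ⟨_, i, fun k => hs.ind_y_u hy hu i (σ i) k⟩
  u_u := hs.indThrough_u_u hu

end MovedSquareBracket

end LoopBracket

/-! ## The relations between the coordinates -/

section Relations

variable {K A : Type*} [Field K] [Ring A] [Algebra K A] {N : ℕ}

open DoubleBracket

/-- The product `u 1 * ⋯ * u n`. -/
def pathProd (u : ZMod N → Aˣ) : ℕ → Aˣ
  | 0 => 1
  | n + 1 => pathProd u n * u (n + 1 : ℕ)

theorem pathProd_eq_of_succ_eq (u : ZMod N → Aˣ) {m n : ℕ} (h : n + 1 = m) :
    pathProd u m = pathProd u n * u (m : ℕ) := by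
  subst h; rfl

theorem ZMod.natCast_succ_inj_of_lt {m n : ℕ} (hm : m < N) (hn : n < N) :
    ((m + 1 : ℕ) : ZMod N) = (n + 1 : ℕ) ↔ m = n := by
  rw [Nat.cast_succ, Nat.cast_succ, add_left_inj, ZMod.natCast_eq_natCast_iff]
  exact ⟨fun h => Nat.ModEq.eq_of_lt_of_lt h hm hn, fun h => h ▸ rfl⟩

/-- The two alternatives exclude each other, and the second is the passage from the last vertex to
the first. For `N = 1` only the second occurs, the vertex being its own neighbour. -/
theorem ZMod.natCast_succ_eq_add_one_iff [NeZero N] {m n : ℕ} (hm : m < N) (hn : n < N) :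
    ((m + 1 : ℕ) : ZMod N) = ((n + 1 : ℕ) : ZMod N) + 1 ↔ m = n + 1 ∨ m = 0 ∧ n + 1 = N := by
  rw [Nat.cast_succ, add_left_inj]
  rcases (Nat.succ_le_of_lt hn).lt_or_eq with h | h
  · rw [ZMod.natCast_eq_natCast_iff]
    refine ⟨fun e => .inl (Nat.ModEq.eq_of_lt_of_lt e hm h), ?_⟩
    rintro (rfl | h')
    · rfl
    · omega
  · have : ((n + 1 : ℕ) : ZMod N) = (0 : ℕ) := by rw [← Nat.succ_eq_add_one, h]; simp
    rw [this, ZMod.natCast_eq_natCast_iff]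
    refine ⟨fun e => .inr ⟨Nat.ModEq.eq_of_lt_of_lt e hm (NeZero.pos N), h⟩, ?_⟩
    rintro (h' | ⟨rfl, -⟩)
    · omega
    · rfl

variable {D : DoubleBracket K A} {x y : ZMod N → A} {u : ZMod N → Aˣ}

/-- The sum telescopes: at an inner vertex `t` the contributions of the incoming and the outgoing
path cancel, and only the two ends of the product remain. -/
theorem DoubleBracket.ind_pathProd {w v : A} {t : ZMod N}
    (hw : ∀ k, D.ind w (u k) =
      (if k = Equiv.addRight 1 t then v * u k else 0) - if k = t then u k * v else 0) (n : ℕ) :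
    D.ind w (pathProd u n) =
      (if (0 : ZMod N) = t then v * pathProd u n else 0) -
        if (n : ZMod N) = t then pathProd u n * v else 0 := by
  induction n with
  | zero => simp [pathProd, ind_eq_indThrough, indThrough_one_right]
  | succ n ih =>
    rw [pathProd, Units.val_mul, ind_mul, ih, hw]
    simp only [Equiv.coe_addRight, Nat.cast_add, Nat.cast_one, add_left_inj]
    split_ifs <;> noncomm_ring

/-- The path is closed, since `N = 0` in `ZMod N`; so both end terms occur together and form a
commutator, or neither occurs. -/
theorem DoubleBracket.cyc_ind_pathProd {w v : A} {t : ZMod N}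
    (hw : ∀ k, D.ind w (u k) =
      (if k = Equiv.addRight 1 t then v * u k else 0) - if k = t then u k * v else 0) :
    cyc K (D.ind w (pathProd u N)) = 0 := by
  rw [ind_pathProd hw, ZMod.natCast_self, map_sub, sub_eq_zero]
  split_ifs
  · exact cyc_mul_comm ..
  · rfl

theorem DoubleBracket.ind_pathProd_pathProd (hu : ∀ m i j, D.indThrough m (u i) (u j) = 0)
    (m n : ℕ) : D.ind (pathProd u m) (pathProd u n) = 0 := by
  -- The parameter must stay arbitrary: expanding a product in the first argument changes it.
  have h1 : ∀ r i, D.indThrough r (u i) (pathProd u n) = 0 := by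
    intro r i
    induction n with
    | zero => simp [pathProd, indThrough_one_right]
    | succ n ih => simp [pathProd, indThrough_mul_right, hu, ih]
  have h2 : ∀ r, D.indThrough r (pathProd u m) (pathProd u n) = 0 := by
    induction m with
    | zero => simp [pathProd, indThrough_one_left]
    | succ m ih => simp [pathProd, indThrough_mul_left, h1, ih]
  rw [ind_eq_indThrough, h2]

theorem cyc_conj (r : Aˣ) (a : A) : cyc K (r * a * ↑r⁻¹) = cyc K a := by
  rw [cyc_mul_comm, Units.inv_mul_cancel_left]

/-- `L` consists of the loops `x i`, `y i`, carried to the beginning of the path `u 1 * ⋯ * u N`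
along this path, and of the path itself. -/
structure LoopWeights.IsTransported (L : LoopWeights A) (x y : ZMod N → A) (u : ZMod N → Aˣ) :
    Prop where
  X_eq : ∀ n < N, L.X (n + 1) = pathProd u n * x (n + 1 : ℕ) * ↑(pathProd u n)⁻¹
  Y_eq : ∀ n < N, L.Y (n + 1) = pathProd u n * y (n + 1 : ℕ) * ↑(pathProd u n)⁻¹
  Z_eq : L.Z = pathProd u N

/-- The product of two transported loops at neighbouring vertices. -/
theorem cyc_transported_mul [NeZero N] {L : LoopWeights A} {U V : ℕ → A} {v w : ZMod N → A}
    (hU : ∀ n < N, U (n + 1) = pathProd u n * v (n + 1 : ℕ) * ↑(pathProd u n)⁻¹)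
    (hV : ∀ n < N, V (n + 1) = pathProd u n * w (n + 1 : ℕ) * ↑(pathProd u n)⁻¹)
    (hZ : L.Z = pathProd u N) {m n : ℕ} (hm : m < N) (hn : n < N) :
    (if ((m + 1 : ℕ) : ZMod N) = Equiv.addRight 1 ((n + 1 : ℕ) : ZMod N) then
      cyc K (v (m + 1 : ℕ) * ↑(u (n + 1 : ℕ))⁻¹ * w (n + 1 : ℕ) * u (n + 1 : ℕ)) else 0) =
    (if m + 1 = n + 1 + 1 then cyc K (U (m + 1) * V (n + 1)) else 0) +
      if m + 1 = 1 ∧ n + 1 = N then cyc K (U 1 * L.Z⁻¹ʳ * V N * L.Z) else 0 := by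
  rw [Equiv.coe_addRight]
  simp only [ZMod.natCast_succ_eq_add_one_iff hm hn]
  by_cases h1 : m = n + 1
  · subst h1
    rw [if_pos (.inl rfl), if_pos rfl, if_neg (by omega), add_zero, hU _ hm, hV _ hn,
      ← cyc_conj (pathProd u (n + 1))]
    simp [pathProd, mul_assoc]
  · by_cases h2 : m = 0 ∧ n + 1 = N
    · obtain ⟨rfl, h3⟩ := h2
      have h4 : ((n + 1 : ℕ) : ZMod N) = (N : ℕ) := by rw [h3]
      rw [if_pos (.inr ⟨rfl, h3⟩), if_neg (by omega), if_pos ⟨rfl, h3⟩, zero_add, hU 0 hm, hZ,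
        Ring.inverse_unit, pathProd_eq_of_succ_eq u h3, show V N = V (n + 1) by rw [h3], hV n hn,
        h4]
      simp [pathProd, mul_assoc]
    · rw [if_neg (by tauto), if_neg (by omega), if_neg (by omega), add_zero]

/-- Each class is replaced by that of the loop before transport. The brackets of loops are then
rewritten in the transported coordinates, where passing from vertex `N` to vertex `1` produces the
conjugation by `Z`. -/
theorem LoopBracket.satisfiesRelations [NeZero N]
    (hl : LoopBracket D (Equiv.addRight 1) x y u) {L : LoopWeights A} (hL : L.IsTransported x y u) : D.SatisfiesRelations N L := by
  have hX : ∀ n < N, cyc K (L.X (n + 1)) = cyc K (x (n + 1 : ℕ)) := fun n hn => by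
    rw [hL.X_eq n hn, cyc_conj]
  have hY : ∀ n < N, cyc K (L.Y (n + 1)) = cyc K (y (n + 1 : ℕ)) := fun n hn => by
    rw [hL.Y_eq n hn, cyc_conj]
  have hI : ∀ {p : ℕ → Prop}, (∀ n < N, p (n + 1)) → ∀ i ∈ Finset.Icc 1 N, p i := by
    intro p hp i hi
    obtain ⟨h1, h2⟩ := Finset.mem_Icc.1 hi
    obtain ⟨n, rfl⟩ := Nat.exists_eq_add_of_le' h1
    exact hp n h2
  constructor
  · refine hI fun m hm => hI fun n hn => ?_
    rw [hX m hm, hX n hn, cyclicBracket_cyc, hl.x_x, map_zero]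
  · refine hI fun m hm => hI fun n hn => ?_
    rw [hY m hm, hX n hn, cyclicBracket_cyc, cyc_ind_skew, hl.x_y,
      cyc_transported_mul hL.X_eq hL.Y_eq hL.Z_eq hn hm]
    simp only [map_sub, apply_ite (cyc K), map_zero, ZMod.natCast_succ_inj_of_lt hm hn,
      Nat.add_right_cancel_iff]
    by_cases h : m = n
    · subst h
      -- Both loops sit at one vertex, so a single conjugation transports their product.
      rw [hL.Y_eq m hm, hL.X_eq m hm, ← cyc_conj (pathProd u m) (y _ * x _)]
      simp only [mul_assoc, Units.inv_mul_cancel_left]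
      abel
    · simp only [if_neg h]
      abel
  · refine hI fun m hm => hI fun n hn => ?_
    rw [hY m hm, hY n hn, cyclicBracket_cyc, hl.y_y,
      cyc_transported_mul hL.Y_eq hL.Y_eq hL.Z_eq hn hm,
      cyc_transported_mul hL.Y_eq hL.Y_eq hL.Z_eq hm hn]
    simp only [map_add, map_sub, apply_ite (cyc K), map_zero]
    abel
  · refine hI fun n hn => ?_
    obtain ⟨v, t, hv⟩ := hl.x_u (n + 1 : ℕ)
    rw [hX n hn, hL.Z_eq, cyclicBracket_cyc, cyc_ind_skew, cyc_ind_pathProd hv, neg_zero]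
  · refine hI fun n hn => ?_
    obtain ⟨v, t, hv⟩ := hl.y_u (n + 1 : ℕ)
    rw [hY n hn, hL.Z_eq, cyclicBracket_cyc, cyc_ind_skew, cyc_ind_pathProd hv, neg_zero]
  · rw [hL.Z_eq, cyclicBracket_cyc, ind_pathProd_pathProd hl.u_u, map_zero]

end Relations

/-! ## The leapfrog map on transported loops -/

section Leapfrog

variable {A : Type*} [Ring A] {N : ℕ} {u : ZMod N → Aˣ}

/-- The twist makes the transport formula valid one index further: at `N + 1` the loop is the first
one, carried once around the closed path. -/
theorem twist_succ [NeZero N] {U : ℕ → A} {v : ZMod N → A}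
    (hU : ∀ n < N, U (n + 1) = pathProd u n * v (n + 1 : ℕ) * ↑(pathProd u n)⁻¹) {n : ℕ}
    (hn : n ≤ N) :
    twist N (pathProd u N : A) U (n + 1) =
      pathProd u n * v (n + 1 : ℕ) * ↑(pathProd u n)⁻¹ := by
  rcases hn.lt_or_eq with h | rfl
  · rw [twist, if_neg (by omega), if_neg (by omega), hU n h]
  · rw [twist, if_neg (by omega), if_pos rfl, Ring.inverse_unit, hU 0 (NeZero.pos n)]
    simp [pathProd]

/-- The same loop seen from the end of `u n` instead of its beginning. This form also covers the
index `0`, because removing `Z` from the last transport leaves only the inverse of `u N`. -/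
theorem twist_eq_conj [NeZero N] {U : ℕ → A} {v : ZMod N → A}
    (hU : ∀ n < N, U (n + 1) = pathProd u n * v (n + 1 : ℕ) * ↑(pathProd u n)⁻¹) {n : ℕ}
    (hn : n ≤ N) :
    twist N (pathProd u N : A) U n =
      pathProd u n * (↑(u n)⁻¹ * v n * u n) * ↑(pathProd u n)⁻¹ := by
  cases n with
  | zero =>
    obtain ⟨n, h⟩ := Nat.exists_eq_succ_of_ne_zero (NeZero.ne N)
    have h' : n + 1 = N := h.symm
    have h3 : ((n + 1 : ℕ) : ZMod N) = (0 : ℕ) := by rw [h', ZMod.natCast_self, Nat.cast_zero]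
    have h4 : ((N : ℕ) : ZMod N) = (0 : ℕ) := by rw [ZMod.natCast_self, Nat.cast_zero]
    rw [twist, if_pos rfl, Ring.inverse_unit, show U N = U (n + 1) by rw [h'], hU n (by omega),
      pathProd_eq_of_succ_eq u h', h3, h4]
    simp [pathProd, mul_assoc]
  | succ n =>
    rw [twist_succ hU (by omega)]
    simp [pathProd, mul_assoc]

/-- The leapfrog map in terms of the loops `x i`, `y i` with sums `t i`. -/
theorem LoopWeights.IsTransported.leapfrog [NeZero N] {L : LoopWeights A} {x y : ZMod N → A}
    (hL : L.IsTransported x y u) {t : ZMod N → Aˣ} (ht : ∀ i, x i + y i = t i) :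
    (leapfrog N L).IsTransported
      (fun i => ↑(u (i - 1))⁻¹ * ↑(t (i - 1))⁻¹ * x (i - 1) * u (i - 1) * t i)
      (fun i => ↑(t i)⁻¹ * y i * u i * t (i + 1) * ↑(u i)⁻¹) u := by
  have key : ∀ {n : ℕ}, n ≤ N → twist N L.Z L.X (n + 1) + twist N L.Z L.Y (n + 1) =
      ↑(pathProd u n * t (n + 1 : ℕ) * (pathProd u n)⁻¹) := fun hn => by
    rw [hL.Z_eq, twist_succ hL.X_eq hn, twist_succ hL.Y_eq hn, ← add_mul, ← mul_add, ht]
    simp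
  -- The new `X (n + 1)` combines sums with indices `n` and `n + 1`; this form carries the former to
  -- the vertex of the latter.
  have key' : ∀ {n : ℕ}, n ≤ N → twist N L.Z L.X n + twist N L.Z L.Y n =
      ↑(pathProd u n * ((u n)⁻¹ * t n * u n) * (pathProd u n)⁻¹) := fun hn => by
    rw [hL.Z_eq, twist_eq_conj hL.X_eq hn, twist_eq_conj hL.Y_eq hn, ← add_mul, ← mul_add,
      ← add_mul, ← mul_add, ht]
    simp
  refine ⟨fun n hn => ?_, fun n hn => ?_, hL.Z_eq⟩
  · simp only [_root_.leapfrog, Nat.add_sub_cancel]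
    rw [key hn.le, key' hn.le, Ring.inverse_unit, hL.Z_eq, twist_eq_conj hL.X_eq hn.le]
    simp [mul_assoc]
  · simp only [_root_.leapfrog]
    rw [key hn.le, key (Nat.succ_le_of_lt hn), Ring.inverse_unit, hL.Z_eq,
      twist_succ hL.Y_eq hn.le]
    simp [mul_assoc, pathProd]

theorem LoopWeights.IsTransported.agree {L L' : LoopWeights A} {x y : ZMod N → A}
    (hL : L.IsTransported x y u) (hL' : L'.IsTransported x y u) : L.Agree N L' := by
  refine ⟨fun i hi => ?_, hL.Z_eq.trans hL'.Z_eq.symm⟩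
  obtain ⟨h1, h2⟩ := Finset.mem_Icc.1 hi
  obtain ⟨n, rfl⟩ := Nat.exists_eq_add_of_le' h1
  rw [hL.X_eq n h2, hL.Y_eq n h2, hL'.X_eq n h2, hL'.Y_eq n h2]
  exact ⟨rfl, rfl⟩

/-! ### The coordinates of the network as transported loops. -/

variable {s : SquareWeights N A} {a b c d f : ZMod N → Aˣ}

theorem SquareWeights.isTransported_loopWeights [NeZero N] (ha : ∀ i, s.a i = a i)
    (hb : ∀ i, s.b i = b i) (hc : ∀ i, s.c i = c i) (hd : ∀ i, s.d i = d i) :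
    s.loopWeights.IsTransported (fun i => ↑(c (i - 1))⁻¹ * a i)
      (fun i => ↑(c (i - 1))⁻¹ * b i * ↑(d i * c i)⁻¹) (fun i => d i * c i) := by
  have h2 : ∀ n : ℕ, (n : ZMod N) + 2 = n + 1 + 1 := fun n => by ring
  -- The product `z` is the path without its last factor `c`, which accounts for the inverses of `c`
  -- in the loops.
  have hz : ∀ n, s.z (n + 1) =
      ↑(pathProd (fun i => d i * c i) (n + 1) * (c (n + 1 : ℕ))⁻¹) := by
    intro n
    induction n with
    | zero => simp [SquareWeights.z, pathProd, hd]
    | succ n ih =>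
      rw [SquareWeights.z, ih, hc, hd, pathProd.eq_2 _ (n + 1)]
      simp [mul_assoc, h2]
  refine ⟨fun n hn => ?_, fun n hn => ?_, ?_⟩
  · cases n with
    | zero => simp [SquareWeights.loopWeights, hc, ha, pathProd]
    | succ n =>
      simp only [SquareWeights.loopWeights, hz, ha, hc, Ring.inverse_unit]
      simp [mul_assoc, h2]
  · cases n with
    | zero => simp [SquareWeights.loopWeights, hc, hb, hd, pathProd, mul_assoc]
    | succ n =>
      simp only [SquareWeights.loopWeights, hz, hb, hc, hd, Ring.inverse_unit]
      simp [mul_assoc, h2]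
  -- The formula for `z` fails at the index `0`, where `z` has a default value, so `N` is written as
  -- a successor.
  · obtain ⟨n, h⟩ := Nat.exists_eq_succ_of_ne_zero (NeZero.ne N)
    have h' : n + 1 = N := h.symm
    simp only [SquareWeights.loopWeights]
    rw [show s.z N = s.z (n + 1) by rw [h'], hz, hc, h']
    simp

theorem SquareWeights.isTransported_movedLoopWeights (ha : ∀ i, s.a i = a i)
    (hb : ∀ i, s.b i = b i) (hc : ∀ i, s.c i = c i) (hd : ∀ i, s.d i = d i) :
    s.movedLoopWeights.IsTransported (fun i => c (i - 1) * ↑(a i)⁻¹)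
      (fun i => d i * ↑(a (i + 1))⁻¹ * ↑(a i * b i)⁻¹) (fun i => a i * b i) := by
  have hξ : ∀ n, s.ξ n = pathProd (fun i => a i * b i) n := by
    intro n
    induction n with
    | zero => simp [SquareWeights.ξ, pathProd]
    | succ n ih =>
      rw [SquareWeights.ξ, ih, ha, hb, pathProd]
      simp [mul_assoc]
  refine ⟨fun n hn => ?_, fun n hn => ?_, hξ N⟩
  · simp only [SquareWeights.movedLoopWeights, hξ, ha, hc, Ring.inverse_unit]
    simp [mul_assoc]
  · simp only [SquareWeights.movedLoopWeights, hξ, ha, hb, hd, Ring.inverse_unit]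
    simp [mul_assoc, add_assoc, one_add_one_eq_two]

/-- The square moves followed by the change of squares realize the leapfrog map. -/
theorem SquareWeights.isTransported_leapfrog [NeZero N] (ha : ∀ i, s.a i = a i)
    (hb : ∀ i, s.b i = b i) (hc : ∀ i, s.c i = c i) (hd : ∀ i, s.d i = d i) (hf : ∀ i, s.f i = f i) {e : ZMod N → Aˣ}
    (he : ∀ i, e i = d i * c i * (f i)⁻¹ * b i * (c i)⁻¹) :
    (leapfrog N s.loopWeights).IsTransported
      (fun i => ((f (i - 1))⁻¹ * (a (i - 1) * d (i - 1)) : Aˣ) * ↑(d i * c i * (f i)⁻¹)⁻¹)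
      (fun i => e i * ↑(d (i + 1) * c (i + 1) * (f (i + 1))⁻¹)⁻¹ *
        ↑(d i * c i * (f i)⁻¹ * f i)⁻¹)
      (fun i => d i * c i * (f i)⁻¹ * f i) := by
  -- Factoring out the common ends leaves exactly the weight `f` of the square move. Its
  -- invertibility makes the sums in the leapfrog map invertible.
  have ht : ∀ i, (↑(c (i - 1))⁻¹ * a i + ↑(c (i - 1))⁻¹ * b i * ↑(d i * c i)⁻¹ : A) =
      ↑((c (i - 1))⁻¹ * f i * (d i * c i)⁻¹) := by
    intro i
    rw [Units.val_mul, Units.val_mul, ← hf, SquareWeights.f, ha, hb, hc, hd]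
    simp [mul_add, add_mul, mul_assoc, add_comm]
  have := (s.isTransported_loopWeights ha hb hc hd).leapfrog ht
  convert this using 2 with i i i
  · simp [mul_assoc]
  · simp [he, mul_assoc]
  · simp

end Leapfrog

/-! ## The network -/

section NetworkBracket

variable {K R : Type*} [Field K] [Ring R] [Algebra K R] {N : ℕ} [NeZero N]

open DoubleBracket

/-- Only the two outgoing edges at a white vertex and the two incoming ones at a black vertex
contribute, and such a pair always has one index. The shifted indices belong to the third edges. -/
theorem vertexSum_eq (w : Edge N → R) (k k' : EdgeKind) (i j : ZMod N) :
    vertexSum K w (k, i) (k', j) = if i = j then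
      (if k = .β ∧ k' = .α ∨ k = .γ ∧ k' = .q then w (k, i) ⊗ₜ[K] w (k', j) else 0) +
        (if k = .β ∧ k' = .γ ∨ k = .α ∧ k' = .p then w (k', j) ⊗ₜ[K] w (k, i) else 0) else 0 := by
  have h : ∀ (P Q : Prop) [Decidable P] [Decidable Q] (t : R ⊗[K] R),
      ∑ x : ZMod N, (if (P ∧ i = x) ∧ Q ∧ j = x then t else 0) =
        if i = j then (if P ∧ Q then t else 0) else 0 := by
    intro P Q _ _ t
    rw [Finset.sum_eq_single i (fun b _ hb => if_neg fun h => hb h.1.2.symm) (by simp), ← ite_and]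
    exact if_congr (by tauto) rfl rfl
  simp only [vertexSum, Fintype.sum_prod_type, Fintype.sum_bool, whiteVertex, blackVertex,
    Prod.mk.injEq, Finset.sum_add_distrib, h]
  rcases eq_or_ne i j with rfl | hij
  · cases k <;> cases k' <;> simp
  · simp [hij]

theorem edgeBracket_eq (w : Edge N → R) (k k' : EdgeKind) (i j : ZMod N) :
    edgeBracket K w (k, i) (k', j) = if i = j then (2⁻¹ : K) •
      ((if k = .β ∧ k' = .α ∨ k = .γ ∧ k' = .q then w (k, i) ⊗ₜ[K] w (k', j) else 0) +
        (if k = .β ∧ k' = .γ ∨ k = .α ∧ k' = .p then w (k', j) ⊗ₜ[K] w (k, i) else 0) -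
        (if k' = .β ∧ k = .α ∨ k' = .γ ∧ k = .q then w (k, i) ⊗ₜ[K] w (k', j) else 0) -
        (if k' = .β ∧ k = .γ ∨ k' = .α ∧ k = .p then w (k', j) ⊗ₜ[K] w (k, i) else 0)) else 0 := by
  rw [edgeBracket, vertexSum_eq, vertexSum_eq]
  rcases eq_or_ne i j with rfl | hij
  · simp only [if_true, map_add, apply_ite (TensorProduct.comm K R R), map_zero,
      TensorProduct.comm_tmul, sub_add_eq_sub_sub]
  · simp [hij, hij.symm]

theorem indThrough_edge {D : DoubleBracket K R} {w : Edge N → R} (hD : D.IsNetworkBracket w)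
    (m : R) (k k' : EdgeKind) (i j : ZMod N) :
    D.indThrough m (w (k, i)) (w (k', j)) = if i = j then (2⁻¹ : K) •
      ((if k = .β ∧ k' = .α ∨ k = .γ ∧ k' = .q then w (k, i) * m * w (k', j) else 0) +
        (if k = .β ∧ k' = .γ ∨ k = .α ∧ k' = .p then w (k', j) * m * w (k, i) else 0) -
        (if k' = .β ∧ k = .α ∨ k' = .γ ∧ k = .q then w (k, i) * m * w (k', j) else 0) -
        (if k' = .β ∧ k = .γ ∨ k' = .α ∧ k = .p then w (k', j) * m * w (k, i) else 0)) else 0 := by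
  rw [indThrough, hD, edgeBracket_eq]
  simp only [apply_ite (mulThrough K m), map_smul, map_add, map_sub, map_zero, mulThrough_tmul]

set_option linter.unusedSimpArgs false in
-- The weight `δ` has zero bracket with every edge, so the brackets of `d` come entirely from its
-- factors `p` and `q`.
theorem DoubleBracket.IsNetworkBracket.squareBracket {D : DoubleBracket K R} {w : Edge N → Rˣ}
    (hD : D.IsNetworkBracket fun e => (w e : R)) :
    SquareBracket D (2⁻¹ : K) (fun i => w (.α, i) * (w (.p, i))⁻¹) (fun i => w (.β, i))
      (fun i => (w (.q, i))⁻¹ * w (.γ, i)) (fun i => w (.p, i) * w (.δ, i) * w (.q, i)) := by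
  have h := indThrough_edge hD
  constructor <;> intro m i j <;> rcases eq_or_ne i j with rfl | hij
  all_goals
    simp [*, indThrough_mul_left, indThrough_mul_right, indThrough_inv_left, indThrough_inv_right,
      mul_assoc]
end NetworkBracket

/-! ## The leapfrog map preserves the brackets -/

section MainTheorem

variable {K R : Type*} [Field K] [Ring R] [Algebra K R] {N : ℕ}

theorem DoubleBracket.IsNetworkBracket.leapfrogInvariant [NeZero N]
    {D : DoubleBracket K R} {w : Edge N → R}
    (hD : D.IsNetworkBracket w) (h2 : (2 : K) ≠ 0) (hw : ∀ e, IsUnit (w e))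
    (hf : ∀ i, IsUnit ((squareWeights w).f i)) : D.LeapfrogInvariant w := by
  choose w' hw' using hw
  obtain rfl : (fun e => (w' e : R)) = w := funext hw'
  choose f hf using hf
  set s := squareWeights fun e => (w' e : R)
  set a : ZMod N → Rˣ := fun i => w' (.α, i) * (w' (.p, i))⁻¹
  set b : ZMod N → Rˣ := fun i => w' (.β, i)
  set c : ZMod N → Rˣ := fun i => (w' (.q, i))⁻¹ * w' (.γ, i)
  set d : ZMod N → Rˣ := fun i => w' (.p, i) * w' (.δ, i) * w' (.q, i)
  have ha : ∀ i, s.a i = a i := fun i => by simp [s, a, squareWeights]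
  have hb : ∀ i, s.b i = b i := fun i => rfl
  have hc : ∀ i, s.c i = c i := fun i => by simp [s, c, squareWeights]
  have hd : ∀ i, s.d i = d i := fun i => by simp [s, d, squareWeights]
  have hf' : ∀ i, (f i : R) = b i + a i * d i * c i := fun i => by
    rw [hf, SquareWeights.f, ha, hb, hc, hd]
  have hh : (2⁻¹ : K) + 2⁻¹ = 1 := by rw [← two_mul, mul_inv_cancel₀ h2]
  let e : ZMod N → Rˣ := fun i => d i * c i * (f i)⁻¹ * b i * (c i)⁻¹
  -- Substituting `b = f - a * d * c` into the new top weight expresses it through `u`, `v`, `f` and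
  -- `d`.
  have he : ∀ i, (e i : R) = d i - (d i * c i : Rˣ) * ↑(f i)⁻¹ * (a i * d i : Rˣ) := fun i => by
    have hb' : (b i : R) = f i - a i * d i * c i := by rw [hf', add_sub_cancel_right]
    simp [e, hb', mul_sub, sub_mul, mul_assoc]
  have hs : SquareBracket D (2⁻¹ : K) a b c d := hD.squareBracket
  have hs' := (hs.squareMoveBracket hf').movedSquareBracket he
  have hleap := s.isTransported_leapfrog ha hb hc hd (fun i => (hf i).symm) (e := e) fun i => rfl
  have hmoved := s.postnikov.isTransported_movedLoopWeights
    (a := fun i => d i * c i * (f i)⁻¹) (b := f) (c := fun i => (f i)⁻¹ * (a i * d i)) (d := e)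
    (fun i => by simp [SquareWeights.postnikov, hc, hd, ← hf])
    (fun i => by simp [SquareWeights.postnikov, ← hf])
    (fun i => by simp [SquareWeights.postnikov, ha, hd, ← hf, mul_assoc])
    (fun i => by simp [SquareWeights.postnikov, hb, hc, hd, ← hf, e])
  refine ⟨hmoved.agree hleap, ?_, ?_⟩
  · refine (hs.loopBracket (x := fun i i' => (c i')⁻¹ * a i)
      (y := fun i i' => (c i')⁻¹ * b i * (d i * c i)⁻¹) (fun _ _ => rfl) (fun _ _ => rfl)
      (fun _ => rfl) (Equiv.addRight 1) hh).satisfiesRelations ?_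
    -- The inverse of the cyclic shift is addition of `-1`, whereas the coordinates are written with
    -- `i - 1`.
    simpa [sub_eq_add_neg] using s.isTransported_loopWeights ha hb hc hd
  · refine (hs'.loopBracket (x := fun i i' => (f i')⁻¹ * (a i' * d i') * (d i * c i * (f i)⁻¹)⁻¹)
      (y := fun i i' => e i * (d i' * c i' * (f i')⁻¹)⁻¹ * (d i * c i * (f i)⁻¹ * f i)⁻¹)
      (fun _ _ => rfl) (fun _ _ => rfl) (fun _ => rfl) (Equiv.addRight 1) hh).satisfiesRelations ?_
    simpa [sub_eq_add_neg] using hleap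

/-! ### Invertible elements of the free skew field. -/

theorem FreeSkewField.isUnit_ofFree {E : Type*} {r : FreeAlgebra K E} (hr : r ≠ 0) :
    IsUnit (FreeSkewField.ofFree K E r) := by
  let M : Matrix (Fin 1) (Fin 1) (FreeAlgebra K E) := Matrix.of fun _ _ => r
  -- A shorter factorization of a `1 × 1` matrix would have inner size `0`, and such a product is
  -- zero.
  have hM : IsFull M := by
    intro m hm B C h
    obtain rfl : m = 0 := by omega
    exact hr (by simpa [M, Matrix.mul_apply] using congrFun (congrFun h 0) 0)
  have h1 := congrFun (congrFun (FreeSkewField.mk_right M hM) 0) 0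
  have h2 := congrFun (congrFun (FreeSkewField.mk_left M hM) 0) 0
  simp only [Matrix.mul_apply, Fin.sum_univ_one, Matrix.map_apply, Matrix.one_apply_eq] at h1 h2
  exact ⟨⟨_, _, h1, h2⟩, rfl⟩

theorem FreeSkewField.isUnit_ι {E : Type*} (e : E) : IsUnit (FreeSkewField.ι K e) := by
  have h : FreeAlgebra.ι K e ≠ 0 := fun h => by
    simpa using congrArg (FreeAlgebra.lift K fun _ => (1 : K)) h
  simpa [ofFree] using isUnit_ofFree h

/-- In `a * d * c` the weights `p` and `q` cancel against their inverses, so `f` comes from the free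
algebra. -/
theorem FreeSkewField.isUnit_squareWeights_f (i : ZMod N) :
    IsUnit ((squareWeights (FreeSkewField.ι K (E := Edge N))).f i) := by
  let r : FreeAlgebra K (Edge N) := FreeAlgebra.ι K (.β, i) +
    FreeAlgebra.ι K (.α, i) * FreeAlgebra.ι K (.δ, i) * FreeAlgebra.ι K (.γ, i)
  -- Evaluating the weights `β` at `1` and all other weights at `0` sends `r` to `1`.
  have hr : r ≠ 0 := fun h => by
    simpa [r] using congrArg (FreeAlgebra.lift K fun e => if e.1 = .β then (1 : K) else 0) h
  obtain ⟨p, hp⟩ := isUnit_ι (K := K) ((.p, i) : Edge N)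
  obtain ⟨q, hq⟩ := isUnit_ι (K := K) ((.q, i) : Edge N)
  have h := isUnit_ofFree hr
  convert h using 1
  simp [SquareWeights.f, squareWeights, r, ofFree, ← hp, ← hq, mul_assoc]

end MainTheorem

theorem mainTheorem11 (K : Type*) [Field K] (h2 : (2 : K) ≠ 0) (N : ℕ) [NeZero N] :
    (networkBracket K N).LeapfrogInvariant (FreeSkewField.ι K) ∧
    ∀ (R : Type*) [Ring R] [Algebra K R] (D : DoubleBracket K R) (w : Edge N → R),
      (∀ e, IsUnit (w e)) → (∀ i, IsUnit ((squareWeights w).f i)) → D.IsNetworkBracket w →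
        D.LeapfrogInvariant w := by
  refine ⟨?_, fun R _ _ D w hw hf hD => hD.leapfrogInvariant h2 hw hf⟩
  exact DoubleBracket.IsNetworkBracket.leapfrogInvariant
    (FreeSkewField.extendBracket_ι _ (edgeBracket_skew _)) h2 FreeSkewField.isUnit_ι
    FreeSkewField.isUnit_squareWeights_f
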